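/- Let $K,H$ be complex Hilbert spaces, let $A\subseteq B(K)$ be an operator system (a self-adjoint linear subspace of $B(K)$ containing $1$), and let $\varphi\colon A\to B(H)$ be a bounded positive linear map. Let $\mathcal T$ be the space of trace class operators on $H$ with the trace norm, $A\widehat\otimes\mathcal T$ the completed projective tensor product, and $t\colon b\mapsto b^t$ the transpose on $B(H)$ with respect to a fixed orthonormal basis of $H$. Let $\tilde\varphi$ be the bounded linear functional on $A\widehat\otimes\mathcal T$ with $\tilde\varphi(a\otimes b)=\mathrm{Tr}(\varphi(a)b^t)$. For a bounded linear map $\alpha\colon B(H)\to B(H)$ (resp. a bounded functional $\omega$ on $B(H)$) let $\iota\otimes\alpha\colon A\widehat\otimes\mathcal T\to B(K\otimes H)$ (resp. $\iota\otimes\omega\colon A\widehat\otimes\mathcal T\to B(K)$) be the bounded linear map with $a\otimes b\mapsto a\otimes\alpha(b)$ (resp. $a\otimes b\mapsto\omega(b)a$); $(A\widehat\otimes\mathcal T)^+$ is the set of $x$ with $(\iota\otimes\mathrm{id})(x)\ge 0$ in $B(K\otimes H)$. Call $\varphi$ decomposable if it is the sum of a completely positive map and a map $\psi\colon A\to B(H)$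 with $t\circ\psi$ completely positive. A mapping cone is a nonzero convex cone $C$ of positive bounded linear maps $B(H)\to B(H)$ which is closed in the topology of bounded pointwise weak convergence and has a dense subset of maps $\alpha$ such that $x\mapsto a\,\alpha(bxb^*)\,a^*$ lies in $C$ for all $a,b\in B(H)$. Let $S(H)$ be the mapping cone generated by (i.e. the intersection of all mapping cones containing) the maps $x\mapsto\sum_{i=1}^n\omega_i(x)a_i$ with $\omega_i$ normal states of $B(H)$ and $0\le a_i\in B(H)$. Call $\varphi$ entanglement breaking if $\tilde\varphi(x)\ge 0$ for every $x\in A\widehat\otimes\mathcal T$ with $(\iota\otimes\alpha)(x)\ge 0$ for all $\alpha\in S(H)$. Then: (i) $\varphi$ is decomposable if and only if $\tilde\varphi$ is positive on the cone $\{x\in(A\widehat\otimes\mathcal T)^+ : (\iota\otimes t)(x)\ge 0\}$. (ii) $\varphi$ is entanglement breaking if and only if $\tilde\varphi$ is positive on the cone $\{x\in A\widehat\otimes\mathcal T : (\iota\otimes\omega)(x)\ge 0 \text{ for all normal states } \omega \text{ of } B(H)\}$. -/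

import Mathlib

open scoped TensorProduct ComplexOrder InnerProductSpace
open Filter Topology UniformSpace

set_option linter.unusedSectionVars false

noncomputable section

namespace PosMap

section Seminorms

variable {E : Type*} [AddCommGroup E] [Module ℂ E]

theorem norm_smul_eq_of_le (N : E → ℝ) (h0 : N 0 = 0) (h1 : ∀ (c : ℂ) x, N (c • x) ≤ ‖c‖ * N x)
    (c : ℂ) (x : E) : N (c • x) = ‖c‖ * N x := by
  refine le_antisymm (h1 c x) ?_
  by_cases hc : c = 0
  · simp [hc, h0]
  · have h := h1 c⁻¹ (c • x)
    rw [smul_smul, inv_mul_cancel₀ hc, one_smul, norm_inv] at h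
    have hc' : 0 < ‖c‖ := norm_pos_iff.mpr hc
    calc ‖c‖ * N x ≤ ‖c‖ * (‖c‖⁻¹ * N (c • x)) := by gcongr
      _ = N (c • x) := by field_simp

end Seminorms

/-! ### The projective tensor product of two normed spaces -/

section Projective

variable (E F : Type*) [NormedAddCommGroup E] [NormedSpace ℂ E]
  [NormedAddCommGroup F] [NormedSpace ℂ F]

/-- The algebraic tensor product, to be equipped with the projective norm. -/
def AlgTensor : Type _ := E ⊗[ℂ] F

instance : AddCommGroup (AlgTensor E F) := inferInstanceAs (AddCommGroup (E ⊗[ℂ] F))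
instance : Module ℂ (AlgTensor E F) := inferInstanceAs (Module ℂ (E ⊗[ℂ] F))

variable {E F}

/-- The elementary tensor `x ⊗ y`. -/
def AlgTensor.mk (x : E) (y : F) : AlgTensor E F := x ⊗ₜ[ℂ] y

/-- The element `∑ xᵢ ⊗ yᵢ` represented by a finite list of pairs `(xᵢ, yᵢ)`. -/
def listTensor (l : List (E × F)) : AlgTensor E F := (l.map fun p => AlgTensor.mk p.1 p.2).sum

/-- `∑ ‖xᵢ‖ ‖yᵢ‖`. -/
def listCost (l : List (E × F)) : ℝ := (l.map fun p => ‖p.1‖ * ‖p.2‖).sum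

/-- The projective norm: the infimum of `∑ ‖xᵢ‖ ‖yᵢ‖` over all finite representations
`z = ∑ xᵢ ⊗ yᵢ`. -/
def projNorm (z : AlgTensor E F) : ℝ := sInf {r | ∃ l : List (E × F), listTensor l = z ∧ listCost l = r}

theorem listCost_nonneg (l : List (E × F)) : 0 ≤ listCost l := by
  refine List.sum_nonneg ?_
  intro r hr
  obtain ⟨p, -, rfl⟩ := List.mem_map.mp hr
  positivity

theorem exists_listTensor (z : AlgTensor E F) : ∃ l : List (E × F), listTensor l = z := by
  induction z using TensorProduct.induction_on with
  | zero => exact ⟨[], rfl⟩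
  | tmul x y => exact ⟨[(x, y)], add_zero _⟩
  | add x y hx hy =>
    obtain ⟨l, hl⟩ := hx
    obtain ⟨m, hm⟩ := hy
    refine ⟨l ++ m, ?_⟩
    rw [← hl, ← hm]
    simp only [listTensor, List.map_append, List.sum_append]
    rfl

theorem projNorm_le (l : List (E × F)) : projNorm (listTensor l) ≤ listCost l :=
  csInf_le ⟨0, by rintro _ ⟨l, -, rfl⟩; exact listCost_nonneg l⟩ ⟨l, rfl, rfl⟩

theorem le_projNorm (z : AlgTensor E F) (c : ℝ) (h : ∀ l : List (E × F), listTensor l = z → c ≤ listCost l) :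
    c ≤ projNorm z := by
  obtain ⟨l, hl⟩ := exists_listTensor z
  refine le_csInf ⟨_, l, hl, rfl⟩ ?_
  rintro _ ⟨l, hl, rfl⟩
  exact h l hl

theorem projNorm_nonneg (z : AlgTensor E F) : 0 ≤ projNorm z :=
  le_projNorm z 0 fun l _ => listCost_nonneg l

theorem projNorm_zero : projNorm (0 : AlgTensor E F) = 0 :=
  le_antisymm (by simpa [listTensor, listCost] using projNorm_le ([] : List (E × F)))
    (projNorm_nonneg 0)

theorem projNorm_add (z w : AlgTensor E F) : projNorm (z + w) ≤ projNorm z + projNorm w := by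
  rw [← sub_le_iff_le_add']
  refine le_projNorm w _ fun m hm => ?_
  rw [sub_le_comm]
  refine le_projNorm z _ fun l hl => ?_
  rw [sub_le_iff_le_add, ← hl, ← hm]
  have h := projNorm_le (l ++ m)
  simpa [listTensor, listCost] using h

theorem projNorm_smul_le (c : ℂ) (z : AlgTensor E F) : projNorm (c • z) ≤ ‖c‖ * projNorm z := by
  have key : ∀ l : List (E × F), listTensor l = z → projNorm (c • z) ≤ ‖c‖ * listCost l := by
    intro l hl
    have h := projNorm_le (l.map fun p => (c • p.1, p.2))
    have h1 : listTensor (l.map fun p => (c • p.1, p.2)) = c • z := by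
      rw [← hl]
      simp only [listTensor, List.map_map, List.smul_sum]
      congr 1
    have h2 : listCost (l.map fun p => (c • p.1, p.2)) = ‖c‖ * listCost l := by
      simp only [listCost, List.map_map, ← List.sum_map_mul_left]
      congr 1
      refine List.map_congr_left fun p _ => ?_
      simp [norm_smul, mul_assoc]
    rwa [h1, h2] at h
  by_cases hc : c = 0
  · subst hc
    simp [projNorm_zero]
  · have hc' : 0 < ‖c‖ := norm_pos_iff.mpr hc
    rw [← div_le_iff₀' hc']
    refine le_projNorm z _ fun l hl => ?_
    rw [div_le_iff₀' hc']
    exact key l hl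

instance : Norm (AlgTensor E F) := ⟨projNorm⟩

theorem projCore : SeminormedSpace.Core ℂ (AlgTensor E F) where
  norm_nonneg := projNorm_nonneg
  norm_smul := norm_smul_eq_of_le projNorm projNorm_zero projNorm_smul_le
  norm_triangle := projNorm_add

instance : SeminormedAddCommGroup (AlgTensor E F) := SeminormedAddCommGroup.ofCore projCore

instance : NormedSpace ℂ (AlgTensor E F) where
  norm_smul_le := projNorm_smul_le

variable (E F) in
/-- The (completed) projective tensor product of two normed spaces. -/
abbrev ProjTensor : Type _ := Completion (AlgTensor E F)

/-- The elementary tensor `x ⊗ y` in the projective tensor product. -/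
def ProjTensor.mk (x : E) (y : F) : ProjTensor E F := ((AlgTensor.mk x y : AlgTensor E F) : ProjTensor E F)

variable {G : Type*} [NormedAddCommGroup G] [NormedSpace ℂ G]

theorem norm_lift_listTensor_le (f : E →L[ℂ] F →L[ℂ] G) (l : List (E × F)) :
    ‖(TensorProduct.lift f.toLinearMap₁₂ : E ⊗[ℂ] F →ₗ[ℂ] G) (listTensor l)‖ ≤
      ‖f‖ * listCost l := by
  induction l with
  | nil =>
    refine le_of_eq ?_
    change ‖(TensorProduct.lift f.toLinearMap₁₂ : E ⊗[ℂ] F →ₗ[ℂ] G) 0‖ = ‖f‖ * 0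
    simp
  | cons p l ih =>
    change ‖(TensorProduct.lift f.toLinearMap₁₂ : E ⊗[ℂ] F →ₗ[ℂ] G)
      (p.1 ⊗ₜ[ℂ] p.2 + (show E ⊗[ℂ] F from listTensor l))‖ ≤ ‖f‖ * (‖p.1‖ * ‖p.2‖ + listCost l)
    rw [map_add, mul_add, ← mul_assoc]
    refine (norm_add_le _ _).trans (add_le_add ?_ ih)
    simpa using f.le_opNorm₂ p.1 p.2

/-- The linear map on the algebraic tensor product given by a bounded bilinear map. -/
def AlgTensor.lift (f : E →L[ℂ] F →L[ℂ] G) : AlgTensor E F →L[ℂ] G :=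
  LinearMap.mkContinuous
    (show E ⊗[ℂ] F →ₗ[ℂ] G from TensorProduct.lift f.toLinearMap₁₂) ‖f‖ <| by
    intro z
    rcases (norm_nonneg f).eq_or_lt with hf | hf
    · obtain ⟨l, rfl⟩ := exists_listTensor z
      have h := norm_lift_listTensor_le f l
      rw [← hf, zero_mul] at h ⊢
      exact h
    · rw [← div_le_iff₀' hf]
      refine le_projNorm z _ fun l hl => ?_
      rw [div_le_iff₀' hf, ← hl]
      exact norm_lift_listTensor_le f l

variable [CompleteSpace G]

/-- The bounded linear map on the projective tensor product given by a bounded bilinear map: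
the continuous linear extension of `x ⊗ y ↦ f x y`. -/
def ProjTensor.lift (f : E →L[ℂ] F →L[ℂ] G) : ProjTensor E F →L[ℂ] G :=
  (AlgTensor.lift f).extend (Completion.toComplL : AlgTensor E F →L[ℂ] ProjTensor E F)

theorem ProjTensor.lift_coe (f : E →L[ℂ] F →L[ℂ] G) (z : AlgTensor E F) :
    ProjTensor.lift f (z : ProjTensor E F) = AlgTensor.lift f z :=
  ContinuousLinearMap.extend_eq (AlgTensor.lift f)
    (e := (Completion.toComplL : AlgTensor E F →L[ℂ] ProjTensor E F))
    Completion.denseRange_coe (Completion.isUniformInducing_coe _) z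

theorem ProjTensor.lift_mk (f : E →L[ℂ] F →L[ℂ] G) (x : E) (y : F) :
    ProjTensor.lift f (ProjTensor.mk x y) = f x y :=
  (ProjTensor.lift_coe f _).trans (TensorProduct.lift.tmul x y)

end Projective

/-! ### Trace class operators -/

section TraceClass

variable {H : Type*} [NormedAddCommGroup H] [InnerProductSpace ℂ H]

/-- `b = ∑ₙ ⟨ηₙ, ·⟩ ξₙ` with `∑ₙ ‖ξₙ‖ ‖ηₙ‖ < ∞`. -/
structure NuclearRep (b : H →L[ℂ] H) (ξ η : ℕ → H) : Prop where
  summable : Summable fun n => ‖ξ n‖ * ‖η n‖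
  hasSum : ∀ x, HasSum (fun n => ⟪η n, x⟫_ℂ • ξ n) (b x)

theorem NuclearRep.zero : NuclearRep (0 : H →L[ℂ] H) (fun _ => 0) (fun _ => 0) where
  summable := by simp
  hasSum x := by simp

theorem NuclearRep.norm_le [CompleteSpace H] {b : H →L[ℂ] H} {ξ η : ℕ → H} (h : NuclearRep b ξ η) :
    ‖b‖ ≤ ∑' n, ‖ξ n‖ * ‖η n‖ := by
  refine b.opNorm_le_bound (tsum_nonneg fun n => by positivity) fun x => ?_
  have hle : ∀ n, ‖⟪η n, x⟫_ℂ • ξ n‖ ≤ (‖ξ n‖ * ‖η n‖) * ‖x‖ := fun n => by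
    rw [norm_smul]
    calc ‖⟪η n, x⟫_ℂ‖ * ‖ξ n‖ ≤ (‖η n‖ * ‖x‖) * ‖ξ n‖ := by gcongr; exact norm_inner_le_norm _ _
      _ = _ := by ring
  rw [← (h.hasSum x).tsum_eq, ← tsum_mul_right]
  exact tsum_of_norm_bounded (h.summable.mul_right _).hasSum hle

theorem NuclearRep.smul {b : H →L[ℂ] H} {ξ η : ℕ → H} (h : NuclearRep b ξ η) (c : ℂ) :
    NuclearRep (c • b) (fun n => c • ξ n) η where
  summable := by
    simpa only [norm_smul, mul_assoc] using h.summable.mul_left ‖c‖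
  hasSum x := by
    have := (h.hasSum x).const_smul c
    simp only [smul_comm c] at this
    exact this

theorem NuclearRep.add {b c : H →L[ℂ] H} {ξ η ξ' η' : ℕ → H} (h : NuclearRep b ξ η)
    (h' : NuclearRep c ξ' η') :
    ∃ ξ₂ η₂ : ℕ → H, NuclearRep (b + c) ξ₂ η₂ ∧
      ∑' n, ‖ξ₂ n‖ * ‖η₂ n‖ = ∑' n, ‖ξ n‖ * ‖η n‖ + ∑' n, ‖ξ' n‖ * ‖η' n‖ := by
  obtain ⟨u⟩ : Nonempty (ℕ ≃ ℕ ⊕ ℕ) := ⟨Equiv.natSumNatEquivNat.symm⟩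
  have hs : HasSum (fun k : ℕ ⊕ ℕ => ‖Sum.elim ξ ξ' k‖ * ‖Sum.elim η η' k‖)
      (∑' n, ‖ξ n‖ * ‖η n‖ + ∑' n, ‖ξ' n‖ * ‖η' n‖) :=
    HasSum.sum h.summable.hasSum h'.summable.hasSum
  have hs' : HasSum (fun n : ℕ => ‖Sum.elim ξ ξ' (u n)‖ * ‖Sum.elim η η' (u n)‖)
      (∑' n, ‖ξ n‖ * ‖η n‖ + ∑' n, ‖ξ' n‖ * ‖η' n‖) := u.hasSum_iff.mpr hs
  have hx : ∀ x, HasSum (fun k : ℕ ⊕ ℕ => ⟪Sum.elim η η' k, x⟫_ℂ • Sum.elim ξ ξ' k)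
      (b x + c x) := fun x => HasSum.sum (h.hasSum x) (h'.hasSum x)
  have hx' : ∀ x, HasSum (fun n : ℕ => ⟪Sum.elim η η' (u n), x⟫_ℂ • Sum.elim ξ ξ' (u n))
      (b x + c x) := fun x => u.hasSum_iff.mpr (hx x)
  exact ⟨fun n => Sum.elim ξ ξ' (u n), fun n => Sum.elim η η' (u n), ⟨hs'.summable, hx'⟩,
    hs'.tsum_eq⟩

theorem NuclearRep.comp_left {b : H →L[ℂ] H} {ξ η : ℕ → H} (h : NuclearRep b ξ η)
    (c : H →L[ℂ] H) :
    NuclearRep (c ∘L b) (fun n => c (ξ n)) η where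
  summable := by
    refine Summable.of_nonneg_of_le (fun n => by positivity) (fun n => ?_)
      (h.summable.mul_left ‖c‖)
    rw [← mul_assoc]
    gcongr
    exact c.le_opNorm _
  hasSum x := by simpa using c.hasSum (h.hasSum x)

variable (H) in
/-- The trace class operators on `H`, as the operators of the form `∑ₙ ⟨ηₙ, ·⟩ ξₙ` with
`∑ₙ ‖ξₙ‖ ‖ηₙ‖ < ∞` (equivalently, the operators `b` with `Tr |b| < ∞`). -/
def traceClassSubmodule : Submodule ℂ (H →L[ℂ] H) where
  carrier := {b | ∃ ξ η : ℕ → H, NuclearRep b ξ η}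
  zero_mem' := ⟨_, _, NuclearRep.zero⟩
  add_mem' := by
    rintro _ _ ⟨ξ, η, h⟩ ⟨ξ', η', h'⟩
    obtain ⟨ξ₂, η₂, h₂, -⟩ := h.add h'
    exact ⟨ξ₂, η₂, h₂⟩
  smul_mem' := by
    rintro c _ ⟨ξ, η, h⟩
    exact ⟨_, _, h.smul c⟩

variable (H) in
/-- The space `𝒯(H)` of trace class operators; it carries the trace norm. -/
def TraceClass : Type _ := traceClassSubmodule H

instance : AddCommGroup (TraceClass H) := inferInstanceAs (AddCommGroup (traceClassSubmodule H))
instance : Module ℂ (TraceClass H) := inferInstanceAs (Module ℂ (traceClassSubmodule H))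

/-- The underlying bounded operator of a trace class operator. -/
def TraceClass.op (b : TraceClass H) : H →L[ℂ] H := b.1

theorem TraceClass.exists_rep (b : TraceClass H) : ∃ ξ η : ℕ → H, NuclearRep b.op ξ η := b.2

/-- The trace norm `‖b‖₁`, i.e. the infimum of `∑ₙ ‖ξₙ‖ ‖ηₙ‖` over all representations
`b = ∑ₙ ⟨ηₙ, ·⟩ ξₙ` (it equals `Tr |b|`). -/
def traceNorm (b : TraceClass H) : ℝ :=
  sInf {r | ∃ ξ η : ℕ → H, NuclearRep b.op ξ η ∧ ∑' n, ‖ξ n‖ * ‖η n‖ = r}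

theorem traceNorm_le {b : TraceClass H} {ξ η : ℕ → H} (h : NuclearRep b.op ξ η) :
    traceNorm b ≤ ∑' n, ‖ξ n‖ * ‖η n‖ :=
  csInf_le ⟨0, by rintro _ ⟨ξ, η, -, rfl⟩; exact tsum_nonneg fun n => by positivity⟩ ⟨ξ, η, h, rfl⟩

theorem le_traceNorm (b : TraceClass H) (c : ℝ)
    (h : ∀ ξ η : ℕ → H, NuclearRep b.op ξ η → c ≤ ∑' n, ‖ξ n‖ * ‖η n‖) : c ≤ traceNorm b := by
  obtain ⟨ξ, η, hb⟩ := b.exists_rep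
  refine le_csInf ⟨_, ξ, η, hb, rfl⟩ ?_
  rintro _ ⟨ξ, η, hb, rfl⟩
  exact h ξ η hb

theorem traceNorm_nonneg (b : TraceClass H) : 0 ≤ traceNorm b :=
  le_traceNorm b 0 fun _ _ _ => tsum_nonneg fun n => by positivity

theorem traceNorm_zero : traceNorm (0 : TraceClass H) = 0 :=
  le_antisymm (by simpa using traceNorm_le (b := (0 : TraceClass H)) NuclearRep.zero)
    (traceNorm_nonneg 0)

theorem traceNorm_add (b c : TraceClass H) : traceNorm (b + c) ≤ traceNorm b + traceNorm c := by
  rw [← sub_le_iff_le_add']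
  refine le_traceNorm c _ fun ξ' η' h' => ?_
  rw [sub_le_comm]
  refine le_traceNorm b _ fun ξ η h => ?_
  obtain ⟨ξ₂, η₂, h₂, hs⟩ := h.add h'
  rw [sub_le_iff_le_add, ← hs]
  exact traceNorm_le (b := b + c) h₂

theorem traceNorm_smul_le (c : ℂ) (b : TraceClass H) : traceNorm (c • b) ≤ ‖c‖ * traceNorm b := by
  by_cases hc : c = 0
  · subst hc
    simp [traceNorm_zero]
  · have hc' : 0 < ‖c‖ := norm_pos_iff.mpr hc
    rw [← div_le_iff₀' hc']
    refine le_traceNorm b _ fun ξ η h => ?_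
    rw [div_le_iff₀' hc', ← tsum_mul_left]
    refine (traceNorm_le (b := c • b) (h.smul c)).trans (le_of_eq ?_)
    simp only [norm_smul, mul_assoc]

theorem TraceClass.norm_op_le [CompleteSpace H] (b : TraceClass H) : ‖b.op‖ ≤ traceNorm b :=
  le_traceNorm b _ fun _ _ h => h.norm_le

variable [CompleteSpace H]

instance : Norm (TraceClass H) := ⟨traceNorm⟩

theorem traceCore : NormedSpace.Core ℂ (TraceClass H) where
  norm_nonneg := traceNorm_nonneg
  norm_smul := norm_smul_eq_of_le traceNorm traceNorm_zero traceNorm_smul_le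
  norm_triangle := traceNorm_add
  norm_eq_zero_iff b := by
    constructor
    · intro h
      have h0 : ‖b.op‖ ≤ 0 := b.norm_op_le.trans h.le
      exact Subtype.ext (norm_le_zero_iff.mp h0)
    · rintro rfl
      exact traceNorm_zero

instance : NormedAddCommGroup (TraceClass H) := NormedAddCommGroup.ofCore traceCore

instance : NormedSpace ℂ (TraceClass H) where
  norm_smul_le := traceNorm_smul_le

variable (H) in
/-- The inclusion `𝒯(H) ⊆ B(H)`. -/
def TraceClass.incl : TraceClass H →L[ℂ] (H →L[ℂ] H) :=
  LinearMap.mkContinuous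
    { toFun := TraceClass.op, map_add' := fun _ _ => rfl, map_smul' := fun _ _ => rfl } 1
    fun b => by rw [one_mul]; exact b.norm_op_le

variable {ι : Type*} (e : HilbertBasis ι ℂ H)

/-- The trace `Tr b = ∑ᵢ ⟨eᵢ, b eᵢ⟩` of a trace class operator `b`. -/
def trace (b : H →L[ℂ] H) : ℂ := ∑' i, ⟪e i, b (e i)⟫_ℂ

theorem NuclearRep.hasSum_trace {b : H →L[ℂ] H} {ξ η : ℕ → H} (h : NuclearRep b ξ η) :
    HasSum (fun i => ⟪e i, b (e i)⟫_ℂ) (∑' n, ⟪η n, ξ n⟫_ℂ) := by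
  have hn : ∀ n, HasSum (fun i => ⟪η n, e i⟫_ℂ * ⟪e i, ξ n⟫_ℂ) ⟪η n, ξ n⟫_ℂ := fun n =>
    e.hasSum_inner_mul_inner _ _
  have hb : ∀ n, Summable (fun i => ‖⟪η n, e i⟫_ℂ * ⟪e i, ξ n⟫_ℂ‖) ∧
      ∑' i, ‖⟪η n, e i⟫_ℂ * ⟪e i, ξ n⟫_ℂ‖ ≤ ‖ξ n‖ * ‖η n‖ := fun n => by
    have hle : ∀ s : Finset ι, ∑ i ∈ s, ‖⟪η n, e i⟫_ℂ * ⟪e i, ξ n⟫_ℂ‖ ≤ ‖ξ n‖ * ‖η n‖ := fun s => by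
      have h1 : ∑ i ∈ s, ‖⟪e i, ξ n⟫_ℂ‖ ^ 2 ≤ ‖ξ n‖ ^ 2 := e.orthonormal.sum_inner_products_le _
      have h2 : ∑ i ∈ s, ‖⟪e i, η n⟫_ℂ‖ ^ 2 ≤ ‖η n‖ ^ 2 := e.orthonormal.sum_inner_products_le _
      calc ∑ i ∈ s, ‖⟪η n, e i⟫_ℂ * ⟪e i, ξ n⟫_ℂ‖
          = ∑ i ∈ s, ‖⟪e i, ξ n⟫_ℂ‖ * ‖⟪e i, η n⟫_ℂ‖ := by
            refine Finset.sum_congr rfl fun i _ => ?_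
            rw [norm_mul, mul_comm, norm_inner_symm (η n)]
        _ ≤ √(∑ i ∈ s, ‖⟪e i, ξ n⟫_ℂ‖ ^ 2) * √(∑ i ∈ s, ‖⟪e i, η n⟫_ℂ‖ ^ 2) :=
            Real.sum_mul_le_sqrt_mul_sqrt _ _ _
        _ ≤ ‖ξ n‖ * ‖η n‖ := by
            gcongr
            · exact Real.sqrt_le_iff.mpr ⟨norm_nonneg _, h1⟩
            · exact Real.sqrt_le_iff.mpr ⟨norm_nonneg _, h2⟩
    have hsum := summable_of_sum_le (fun i => norm_nonneg (⟪η n, e i⟫_ℂ * ⟪e i, ξ n⟫_ℂ)) hle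
    exact ⟨hsum, hsum.tsum_le_of_sum_le hle⟩
  have hs : Summable fun p : ℕ × ι => ⟪η p.1, e p.2⟫_ℂ * ⟪e p.2, ξ p.1⟫_ℂ := by
    refine Summable.of_norm ?_
    rw [summable_prod_of_nonneg fun p => norm_nonneg _]
    exact ⟨fun n => (hb n).1, Summable.of_nonneg_of_le (fun n => tsum_nonneg fun i => norm_nonneg _)
      (fun n => (hb n).2) h.summable⟩
  have h1 : HasSum (fun p : ℕ × ι => ⟪η p.1, e p.2⟫_ℂ * ⟪e p.2, ξ p.1⟫_ℂ) (∑' n, ⟪η n, ξ n⟫_ℂ) := by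
    have := hs.hasSum.prod_fiberwise hn
    rw [this.tsum_eq]
    exact hs.hasSum
  have h2 := (Equiv.prodComm ι ℕ).hasSum_iff.mpr h1
  refine h2.prod_fiberwise fun i => ?_
  have h3 := (innerSL ℂ (e i)).hasSum (h.hasSum (e i))
  simpa [inner_smul_right] using h3

theorem NuclearRep.norm_trace_le {b : H →L[ℂ] H} {ξ η : ℕ → H} (h : NuclearRep b ξ η) :
    ‖trace e b‖ ≤ ∑' n, ‖ξ n‖ * ‖η n‖ := by
  rw [trace, (h.hasSum_trace e).tsum_eq]
  exact tsum_of_norm_bounded h.summable.hasSum fun n => by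
    rw [mul_comm]; exact norm_inner_le_norm _ _

theorem NuclearRep.trace_add {b c : H →L[ℂ] H} {ξ η ξ' η' : ℕ → H} (h : NuclearRep b ξ η)
    (h' : NuclearRep c ξ' η') : trace e (b + c) = trace e b + trace e c := by
  have := (h.hasSum_trace e).summable.tsum_add (h'.hasSum_trace e).summable
  rw [trace, trace, trace, ← this]
  simp

theorem trace_smul (c : ℂ) (b : H →L[ℂ] H) : trace e (c • b) = c * trace e b := by
  rw [trace, trace, ← tsum_mul_left]
  simp

/-! ### The transpose with respect to an orthonormal basis -/

/-- The conjugation `J` with respect to the orthonormal basis `e`: the coordinates of `J x` are the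
complex conjugates of those of `x`. -/
def conjL : H →L⋆[ℂ] H :=
  LinearMap.mkContinuous
    { toFun := fun x => e.repr.symm (star (e.repr x))
      map_add' := fun x y => by simp
      map_smul' := fun c x => by simp [star_smul] } 1
    fun x => by simp

theorem conjL_apply (x : H) : conjL e x = e.repr.symm (star (e.repr x)) := rfl

theorem norm_conjL (x : H) : ‖conjL e x‖ = ‖x‖ := by simp [conjL_apply]

theorem conjL_conjL (x : H) : conjL e (conjL e x) = x := by simp [conjL_apply]

theorem inner_conjL (x y : H) : ⟪conjL e x, y⟫_ℂ = ⟪conjL e y, x⟫_ℂ := by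
  rw [← e.repr.inner_map_map, ← e.repr.inner_map_map (conjL e y)]
  simp only [conjL_apply, LinearIsometryEquiv.apply_symm_apply, lp.inner_eq_tsum]
  refine tsum_congr fun i => ?_
  simp [mul_comm]

/-- The transpose `b ↦ bᵗ` on `B(H)` with respect to the orthonormal basis `e`: `bᵗ = J b* J`. -/
def transpose : (H →L[ℂ] H) →L[ℂ] (H →L[ℂ] H) :=
  LinearMap.mkContinuous
    { toFun := fun b => ((conjL e).comp (ContinuousLinearMap.adjoint b)).comp (conjL e)
      map_add' := fun b c => by ext x; simp
      map_smul' := fun c b => by ext x; simp [LinearIsometryEquiv.map_smulₛₗ] } 1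
    fun b => by
      refine ContinuousLinearMap.opNorm_le_bound _ (by positivity) fun x => ?_
      change ‖conjL e (ContinuousLinearMap.adjoint b (conjL e x))‖ ≤ 1 * ‖b‖ * ‖x‖
      rw [norm_conjL, one_mul, ← norm_conjL e x, ← LinearIsometryEquiv.norm_map
        ContinuousLinearMap.adjoint b]
      exact ContinuousLinearMap.le_opNorm _ _

theorem transpose_apply (b : H →L[ℂ] H) (x : H) :
    transpose e b x = conjL e (ContinuousLinearMap.adjoint b (conjL e x)) := rfl

/-- The matrix of `bᵗ` in the basis `e` is the transpose of the matrix of `b`. -/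
theorem inner_transpose (b : H →L[ℂ] H) (i j : ι) :
    ⟪e i, transpose e b (e j)⟫_ℂ = ⟪e j, b (e i)⟫_ℂ := by
  classical
  have he : ∀ k, conjL e (e k) = e k := fun k => by
    rw [conjL_apply, e.repr_self]
    have : star (lp.single 2 k (1 : ℂ)) = lp.single (E := fun _ : ι => ℂ) 2 k (1 : ℂ) := by
      ext m
      by_cases hm : m = k
      · subst hm; simp
      · simp [lp.single_apply, hm]
    rw [this, e.repr_symm_single]
  rw [transpose_apply, he, ← inner_conj_symm, inner_conjL, he, inner_conj_symm,
    ContinuousLinearMap.adjoint_inner_left]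

theorem NuclearRep.transpose {b : H →L[ℂ] H} {ξ η : ℕ → H} (h : NuclearRep b ξ η) :
    NuclearRep (transpose e b) (fun n => conjL e (η n)) (fun n => conjL e (ξ n)) where
  summable := by simpa only [norm_conjL, mul_comm] using h.summable
  hasSum x := by
    have hadj : ∀ y, HasSum (fun n => ⟪ξ n, y⟫_ℂ • η n) (ContinuousLinearMap.adjoint b y) := by
      intro y
      have hs : Summable (fun n => ⟪ξ n, y⟫_ℂ • η n) := by
        refine Summable.of_norm_bounded (h.summable.mul_right ‖y‖) fun n => ?_
        rw [norm_smul]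
        calc ‖⟪ξ n, y⟫_ℂ‖ * ‖η n‖ ≤ (‖ξ n‖ * ‖y‖) * ‖η n‖ := by
              gcongr; exact norm_inner_le_norm _ _
          _ = _ := by ring
      convert hs.hasSum using 1
      refine ext_inner_left ℂ fun z => ?_
      rw [ContinuousLinearMap.adjoint_inner_right]
      have h1 : HasSum (fun n => ⟪ξ n, y⟫_ℂ * ⟪z, η n⟫_ℂ) ⟪z, ∑' n, ⟪ξ n, y⟫_ℂ • η n⟫_ℂ := by
        simpa [inner_smul_right] using (innerSL ℂ z).hasSum hs.hasSum
      have h2 : HasSum (fun n => ⟪η n, z⟫_ℂ * ⟪y, ξ n⟫_ℂ) ⟪y, b z⟫_ℂ := by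
        simpa [inner_smul_right] using (innerSL ℂ y).hasSum (h.hasSum z)
      have h3 := Complex.hasSum_conj'.mpr h2
      simp only [map_mul, inner_conj_symm] at h3
      refine HasSum.unique h3 ?_
      simpa only [mul_comm] using h1
    have h1 := (conjL e).hasSum (hadj (conjL e x))
    rw [transpose_apply]
    convert h1 using 1
    ext n
    simp [inner_conjL e (ξ n) x]

end TraceClass

/-! ### Operators on the Hilbert space tensor product -/

section HilbertTensor

variable (K H : Type*) [NormedAddCommGroup K] [InnerProductSpace ℂ K]
  [NormedAddCommGroup H] [InnerProductSpace ℂ H]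

/-- The Hilbert space tensor product `K ⊗ H`. -/
abbrev HilbertTensor : Type _ := Completion (K ⊗[ℂ] H)

variable {K H}

/-- The operator `a ⊗ b` on the Hilbert space `K ⊗ H`: the bounded operator with
`(a ⊗ b)(ξ ⊗ η) = a ξ ⊗ b η`. -/
def opTensor (a : K →L[ℂ] K) (b : H →L[ℂ] H) : HilbertTensor K H →L[ℂ] HilbertTensor K H :=
  ((Completion.toComplL : K ⊗[ℂ] H →L[ℂ] HilbertTensor K H).comp (TensorProduct.mapL a b)).extend
    (Completion.toComplL : K ⊗[ℂ] H →L[ℂ] HilbertTensor K H)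

theorem opTensor_coe (a : K →L[ℂ] K) (b : H →L[ℂ] H) (z : K ⊗[ℂ] H) :
    opTensor a b (z : HilbertTensor K H) =
      ((TensorProduct.mapL a b z : K ⊗[ℂ] H) : HilbertTensor K H) :=
  ContinuousLinearMap.extend_eq
    ((Completion.toComplL : K ⊗[ℂ] H →L[ℂ] HilbertTensor K H).comp (TensorProduct.mapL a b))
    (e := (Completion.toComplL : K ⊗[ℂ] H →L[ℂ] HilbertTensor K H))
    Completion.denseRange_coe (Completion.isUniformInducing_coe _) z

theorem hilbertTensor_ext {S T : HilbertTensor K H →L[ℂ] HilbertTensor K H}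
    (h : ∀ z : K ⊗[ℂ] H, S (z : HilbertTensor K H) = T (z : HilbertTensor K H)) : S = T := by
  ext z
  exact congrFun (Completion.denseRange_coe.equalizer S.continuous T.continuous (funext h)) z

theorem norm_opTensor_le (a : K →L[ℂ] K) (b : H →L[ℂ] H) : ‖opTensor a b‖ ≤ ‖a‖ * ‖b‖ := by
  refine ContinuousLinearMap.opNorm_le_bound _ (by positivity) fun z => ?_
  induction z using Completion.induction_on with
  | hp => exact isClosed_le (by fun_prop) (by fun_prop)
  | ih z =>
    rw [opTensor_coe, Completion.norm_coe, Completion.norm_coe]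
    exact (ContinuousLinearMap.le_opNorm _ _).trans (by gcongr; exact TensorProduct.norm_mapL_le a b)

theorem opTensor_add_left (a a' : K →L[ℂ] K) (b : H →L[ℂ] H) :
    opTensor (a + a') b = opTensor a b + opTensor a' b :=
  hilbertTensor_ext fun z => by
    rw [add_apply, opTensor_coe, opTensor_coe, opTensor_coe,
      TensorProduct.mapL_add_left, add_apply, Completion.coe_add]

theorem opTensor_add_right (a : K →L[ℂ] K) (b b' : H →L[ℂ] H) :
    opTensor a (b + b') = opTensor a b + opTensor a b' :=
  hilbertTensor_ext fun z => by
    rw [add_apply, opTensor_coe, opTensor_coe, opTensor_coe,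
      TensorProduct.mapL_add_right, add_apply, Completion.coe_add]

theorem opTensor_smul_left (c : ℂ) (a : K →L[ℂ] K) (b : H →L[ℂ] H) :
    opTensor (c • a) b = c • opTensor a b :=
  hilbertTensor_ext fun z => by
    rw [smul_apply, opTensor_coe, opTensor_coe,
      TensorProduct.mapL_smul_left, smul_apply, Completion.coe_smul]

theorem opTensor_smul_right (c : ℂ) (a : K →L[ℂ] K) (b : H →L[ℂ] H) :
    opTensor a (c • b) = c • opTensor a b :=
  hilbertTensor_ext fun z => by
    rw [smul_apply, opTensor_coe, opTensor_coe,
      TensorProduct.mapL_smul_right, smul_apply, Completion.coe_smul]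

variable (K H) in
/-- `(a, b) ↦ a ⊗ b` as a bilinear map `B(K) × B(H) → B(K ⊗ H)`. -/
def opTensorBilin :
    (K →L[ℂ] K) →ₗ[ℂ] (H →L[ℂ] H) →ₗ[ℂ] (HilbertTensor K H →L[ℂ] HilbertTensor K H) :=
  LinearMap.mk₂ ℂ (fun (a : K →L[ℂ] K) (b : H →L[ℂ] H) => opTensor a b)
    (fun a a' b => opTensor_add_left a a' b) (fun c a b => opTensor_smul_left c a b)
    (fun a b b' => opTensor_add_right a b b') (fun c a b => opTensor_smul_right c a b)

variable (K H) in
/-- `(a, b) ↦ a ⊗ b` as a bounded bilinear map `B(K) × B(H) → B(K ⊗ H)`. -/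
def opTensorL :
    (K →L[ℂ] K) →L[ℂ] (H →L[ℂ] H) →L[ℂ] (HilbertTensor K H →L[ℂ] HilbertTensor K H) :=
  LinearMap.mkContinuous₂ (E := K →L[ℂ] K) (F := H →L[ℂ] H)
    (G := HilbertTensor K H →L[ℂ] HilbertTensor K H) (σ₁₃ := .id ℂ) (σ₂₃ := .id ℂ)
    (opTensorBilin K H) 1
    fun a b => (norm_opTensor_le a b).trans (by rw [one_mul])

theorem opTensorL_apply (a : K →L[ℂ] K) (b : H →L[ℂ] H) : opTensorL K H a b = opTensor a b := rfl

end HilbertTensor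

/-! ### Operator systems, positive maps and their dual functionals -/

section Maps

variable {K H ι : Type*} [NormedAddCommGroup K] [InnerProductSpace ℂ K] [CompleteSpace K]
  [NormedAddCommGroup H] [InnerProductSpace ℂ H] [CompleteSpace H] (e : HilbertBasis ι ℂ H)

/-- An operator system: a self-adjoint linear space of bounded operators containing `1`. -/
structure IsOperatorSystem (A : Submodule ℂ (K →L[ℂ] K)) : Prop where
  one_mem : (1 : K →L[ℂ] K) ∈ A
  star_mem : ∀ a ∈ A, star a ∈ A

variable {A : Submodule ℂ (K →L[ℂ] K)}

/-- `φ : A → B(H)` maps positive operators to positive operators. -/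
def IsPositiveMap (φ : A →L[ℂ] (H →L[ℂ] H)) : Prop :=
  ∀ a : A, 0 ≤ (a : K →L[ℂ] K) → 0 ≤ φ a

/-- Positivity of an operator matrix `(mᵢⱼ)` as an operator on `K ⊕ ⋯ ⊕ K`. -/
def MatrixPositive {n : ℕ} (m : Matrix (Fin n) (Fin n) (K →L[ℂ] K)) : Prop :=
  ∀ ξ : Fin n → K, 0 ≤ ∑ i, ∑ j, ⟪ξ i, m i j (ξ j)⟫_ℂ

/-- `φ` is completely positive. -/
def IsCompletelyPositive (φ : A →L[ℂ] (H →L[ℂ] H)) : Prop :=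
  ∀ (n : ℕ) (m : Matrix (Fin n) (Fin n) A),
    MatrixPositive (m.map fun a => (a : K →L[ℂ] K)) → MatrixPositive (m.map φ)

/-- `φ` is completely copositive: `t ∘ φ` is completely positive. -/
def IsCompletelyCopositive (φ : A →L[ℂ] (H →L[ℂ] H)) : Prop :=
  IsCompletelyPositive ((transpose e).comp φ)

/-- `φ` is decomposable: the sum of a completely positive and a completely copositive map. -/
def IsDecomposable (φ : A →L[ℂ] (H →L[ℂ] H)) : Prop :=
  ∃ φ₁ φ₂ : A →L[ℂ] (H →L[ℂ] H),
    IsCompletelyPositive φ₁ ∧ IsCompletelyCopositive e φ₂ ∧ φ = φ₁ + φ₂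

theorem exists_rep_dual (φ : A →L[ℂ] (H →L[ℂ] H)) (a : A) (b : TraceClass H) :
    ∃ ξ η : ℕ → H, NuclearRep (φ a ∘L transpose e b.op) ξ η := by
  obtain ⟨ξ, η, h⟩ := b.exists_rep
  exact ⟨_, _, (h.transpose e).comp_left (φ a)⟩

theorem norm_trace_dual_le (φ : A →L[ℂ] (H →L[ℂ] H)) (a : A) (b : TraceClass H) :
    ‖trace e (φ a ∘L transpose e b.op)‖ ≤ ‖φ a‖ * ‖b‖ := by
  have key : ∀ ξ η : ℕ → H, NuclearRep b.op ξ η →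
      ‖trace e (φ a ∘L transpose e b.op)‖ ≤ ‖φ a‖ * ∑' n, ‖ξ n‖ * ‖η n‖ := fun ξ η h => by
    have h' := (h.transpose e).comp_left (φ a)
    refine (h'.norm_trace_le e).trans ?_
    rw [← tsum_mul_left]
    refine h'.summable.tsum_le_tsum (fun n => ?_) (h.summable.mul_left _)
    calc ‖φ a (conjL e (η n))‖ * ‖conjL e (ξ n)‖
        ≤ (‖φ a‖ * ‖conjL e (η n)‖) * ‖conjL e (ξ n)‖ := by
          gcongr; exact ContinuousLinearMap.le_opNorm _ _
      _ = ‖φ a‖ * (‖ξ n‖ * ‖η n‖) := by rw [norm_conjL, norm_conjL]; ring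
  rcases (norm_nonneg (φ a)).eq_or_lt with h0 | h0
  · obtain ⟨ξ, η, h⟩ := b.exists_rep
    have := key ξ η h
    rw [← h0, zero_mul] at this ⊢
    exact this
  · rw [← div_le_iff₀' h0]
    refine le_traceNorm b _ fun ξ η h => ?_
    rw [div_le_iff₀' h0]
    exact key ξ η h

/-- The dual functional `φ̃` on `A ⊗̂ 𝒯(H)`, with `φ̃(a ⊗ b) = Tr (φ(a) bᵗ)`. -/
def dualFunctional (φ : A →L[ℂ] (H →L[ℂ] H)) : ProjTensor A (TraceClass H) →L[ℂ] ℂ :=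
  ProjTensor.lift <| LinearMap.mkContinuous₂
    (LinearMap.mk₂ ℂ (fun (a : A) (b : TraceClass H) => trace e (φ a ∘L transpose e b.op))
      (fun a a' b => by
        obtain ⟨_, _, h⟩ := exists_rep_dual e φ a b
        obtain ⟨_, _, h'⟩ := exists_rep_dual e φ a' b
        rw [map_add, ContinuousLinearMap.add_comp]
        exact h.trace_add e h')
      (fun c a b => by
        rw [map_smul, ContinuousLinearMap.smul_comp]
        exact trace_smul e c _)
      (fun a b b' => by
        obtain ⟨_, _, h⟩ := exists_rep_dual e φ a b
        obtain ⟨_, _, h'⟩ := exists_rep_dual e φ a b'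
        have hb : (b + b').op = b.op + b'.op := rfl
        rw [hb, map_add, ContinuousLinearMap.comp_add]
        exact h.trace_add e h')
      (fun c a b => by
        have hb : (c • b).op = c • b.op := rfl
        rw [hb, map_smul, ContinuousLinearMap.comp_smul]
        exact trace_smul e c _)) ‖φ‖
    fun a b => (norm_trace_dual_le e φ a b).trans (by gcongr; exact φ.le_opNorm a)

theorem dualFunctional_mk (φ : A →L[ℂ] (H →L[ℂ] H)) (a : A) (b : TraceClass H) :
    dualFunctional e φ (ProjTensor.mk a b) = trace e (φ a ∘L transpose e b.op) :=
  ProjTensor.lift_mk _ a b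

/-- The map `ι ⊗ α : A ⊗̂ 𝒯(H) → B(K ⊗ H)`, with `a ⊗ b ↦ a ⊗ α(b)`, for a bounded linear map
`α` of `B(H)` into itself. -/
def idTensor (α : (H →L[ℂ] H) →L[ℂ] (H →L[ℂ] H)) :
    ProjTensor A (TraceClass H) →L[ℂ] (HilbertTensor K H →L[ℂ] HilbertTensor K H) :=
  ProjTensor.lift (G := HilbertTensor K H →L[ℂ] HilbertTensor K H)
    ((opTensorL K H).bilinearComp A.subtypeL (α.comp (TraceClass.incl H)))

theorem idTensor_mk (α : (H →L[ℂ] H) →L[ℂ] (H →L[ℂ] H)) (a : A) (b : TraceClass H) :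
    idTensor α (ProjTensor.mk a b) = opTensor (a : K →L[ℂ] K) (α b.op) :=
  ProjTensor.lift_mk (G := HilbertTensor K H →L[ℂ] HilbertTensor K H) _ a b

/-- The map `ι ⊗ ω : A ⊗̂ 𝒯(H) → B(K)`, with `a ⊗ b ↦ ω(b) a`, for a bounded linear functional
`ω` on `B(H)`. -/
def idTensorFunctional (ω : (H →L[ℂ] H) →L[ℂ] ℂ) :
    ProjTensor A (TraceClass H) →L[ℂ] (K →L[ℂ] K) :=
  ProjTensor.lift
    ((ContinuousLinearMap.lsmul ℂ ℂ).flip.bilinearComp A.subtypeL (ω.comp (TraceClass.incl H)))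

theorem idTensorFunctional_mk (ω : (H →L[ℂ] H) →L[ℂ] ℂ) (a : A) (b : TraceClass H) :
    idTensorFunctional ω (ProjTensor.mk a b) = ω b.op • (a : K →L[ℂ] K) :=
  ProjTensor.lift_mk _ a b

variable (A H) in
/-- The cone `(A ⊗̂ 𝒯(H))⁺`: the elements that are positive as operators on `K ⊗ H`. -/
def posCone : Set (ProjTensor A (TraceClass H)) :=
  {x | 0 ≤ idTensor (.id ℂ (H →L[ℂ] H)) x}

/-! ### Normal states, mapping cones and entanglement breaking maps -/

/-- A normal state of `B(H)`: a state of the form `b ↦ Tr (b ρ)` with `ρ` of trace class. -/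
structure IsNormalState (ω : (H →L[ℂ] H) →L[ℂ] ℂ) : Prop where
  nonneg : ∀ b, 0 ≤ b → 0 ≤ ω b
  map_one : ω 1 = 1
  normal : ∃ ρ : TraceClass H, ∀ b, ω b = trace e (b ∘L ρ.op)

/-- Closedness in the topology of bounded pointwise weak convergence: if a bounded net (filter) in
`S` converges to `α` pointwise in the weak operator topology, then `α` is in `S`. -/
def IsBWClosed (S : Set ((H →L[ℂ] H) →L[ℂ] (H →L[ℂ] H))) : Prop :=
  ∀ (l : Filter ((H →L[ℂ] H) →L[ℂ] (H →L[ℂ] H))) (r : ℝ) (α : (H →L[ℂ] H) →L[ℂ] (H →L[ℂ] H)),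
    l.NeBot → (∀ᶠ β in l, β ∈ S ∧ ‖β‖ ≤ r) →
    (∀ (b : H →L[ℂ] H) (ξ η : H), Tendsto (fun β => ⟪ξ, β b η⟫_ℂ) l (𝓝 ⟪ξ, α b η⟫_ℂ)) → α ∈ S

/-- A mapping cone: a nonzero convex cone `C` of positive maps of `B(H)` into itself which is closed
in the topology of bounded pointwise weak convergence and has a dense subset `D` of maps `α` such
that `x ↦ a α(b x b*) a*` belongs to `C` for all `a, b ∈ B(H)`. -/
structure IsMappingCone (C : Set ((H →L[ℂ] H) →L[ℂ] (H →L[ℂ] H))) : Prop where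
  pos : ∀ α ∈ C, ∀ x, 0 ≤ x → 0 ≤ α x
  ne_zero : ∃ α ∈ C, α ≠ 0
  add_mem : ∀ α ∈ C, ∀ β ∈ C, α + β ∈ C
  smul_mem : ∀ r : ℝ, 0 ≤ r → ∀ α ∈ C, (r : ℂ) • α ∈ C
  closed : IsBWClosed C
  dense : ∃ D ⊆ C, (∀ S, IsBWClosed S → D ⊆ S → C ⊆ S) ∧
    ∀ α ∈ D, ∀ a b : H →L[ℂ] H, ∃ β ∈ C, ∀ x, β x = a * α (b * x * star b) * star a

/-- The maps `x ↦ ∑ᵢ ωᵢ(x) aᵢ` with normal states `ωᵢ` and positive operators `aᵢ`. -/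
def elementaryMaps : Set ((H →L[ℂ] H) →L[ℂ] (H →L[ℂ] H)) :=
  {α | ∃ (n : ℕ) (ω : Fin n → (H →L[ℂ] H) →L[ℂ] ℂ) (a : Fin n → (H →L[ℂ] H)),
    (∀ i, IsNormalState e (ω i)) ∧ (∀ i, 0 ≤ a i) ∧ ∀ x, α x = ∑ i, ω i x • a i}

/-- The mapping cone `S(H)` generated by the maps `x ↦ ∑ᵢ ωᵢ(x) aᵢ`: the intersection of all mapping
cones containing them. -/
def separableCone : Set ((H →L[ℂ] H) →L[ℂ] (H →L[ℂ] H)) :=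
  {α | ∀ C, IsMappingCone C → elementaryMaps e ⊆ C → α ∈ C}

/-- The cone `P(A, C) = {x ∈ A ⊗̂ 𝒯(H) : (ι ⊗ α)(x) ≥ 0 for all α ∈ C}`. -/
def coneP (A : Submodule ℂ (K →L[ℂ] K)) (C : Set ((H →L[ℂ] H) →L[ℂ] (H →L[ℂ] H))) :
    Set (ProjTensor A (TraceClass H)) :=
  {x | ∀ α ∈ C, 0 ≤ idTensor α x}

/-- `φ` is `C`-positive: its dual functional is positive on `P(A, C)`. -/
def IsConePositive (C : Set ((H →L[ℂ] H) →L[ℂ] (H →L[ℂ] H))) (φ : A →L[ℂ] (H →L[ℂ] H)) : Prop :=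
  ∀ x ∈ coneP A C, 0 ≤ dualFunctional e φ x

/-- `φ` is entanglement breaking: it is `S(H)`-positive. -/
def IsEntanglementBreaking (φ : A →L[ℂ] (H →L[ℂ] H)) : Prop :=
  IsConePositive e (separableCone e) φ

end Maps

end PosMap

end

open PosMap

/-!
For (i), the dual functional of `φ` satisfies `φ̃(a ⊗ |u⟩⟨v|) = ⟪J u, φ(a) J v⟫`, and the partial
transpose `ι ⊗ t` acts on `A ⊗̂ 𝒯(H)` itself, with `φ̃ ∘ (ι ⊗ t) = (t ∘ φ)~`. So it has to be seen
that completely positive maps correspond to functionals which are positive on `(A ⊗̂ 𝒯(H))⁺`.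
If `φ` is completely positive and `x ≥ 0`, then `φ̃(x)` is the limit of the values at `x` of the dual
functionals of the compressions of `φ` to spans of finitely many basis vectors
(`tendsto_dualFunctional_compress`), and each of these is the value of a positive matrix over
(the closure of) `A` under `φ`. As `A` need not be closed, this matrix is approximated by matrices
over `A` which are positive up to a small multiple of the identity, and `1 ∈ A` absorbs the error
(`IsCompletelyPositive.re_dualFunctional_nonneg`). Conversely, a functional which is positive on the
positive tensors of finite rank is bounded on elementary tensors, since `a ⊗ |u⟩⟨v|` is dominated
by `‖a‖ / 2 ⊗ (|u⟩⟨u| + |v⟩⟨v|)`, and hence comes from a map `A → B(H)`, which is completely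
positive (`exists_completelyPositive`). A decomposition of `φ` is then the same as a decomposition
of `φ̃` on the tensors of finite rank into a functional positive on one cone and a functional
positive on the other. It exists by the Riesz extension theorem: `(x, x) ↦ φ̃(x)` is positive on the
diagonal for the product of the two cones, and the tensors `1 ⊗ |u⟩⟨u|`, which lie in both cones,
make the diagonal cofinal (`exists_add_of_nonneg_inter`).

Throughout, positivity is replaced by the condition that the real part of the quadratic form be
nonnegative (`Accretive`). This makes it unnecessary to split tensors into hermitian parts: a
functional with nonnegative real part on accretive elements is nonnegative on positive ones
(`nonneg_of_re_nonneg`).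

For (ii), the two cones in question coincide (`mem_coneP_separableCone_iff`), whatever `φ` is.
Maps `x ↦ ω(x) 1` belong to `S(H)`, which gives one inclusion. For the other, the closure of the
elementary maps is a mapping cone (`isMappingCone_elementaryClosure`), so it contains `S(H)`;
the condition `(ι ⊗ α)(x) ≥ 0` passes to bounded pointwise weak limits in `α`, and for
`α = ∑ ωᵢ(·) aᵢ` it says that `∑ (ι ⊗ ωᵢ)(x) ⊗ aᵢ ≥ 0`.
-/

namespace PosMap

/-! ### Elementary tensors in the projective tensor product -/

section Projective

variable {E F G : Type*} [NormedAddCommGroup E] [NormedSpace ℂ E]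
  [NormedAddCommGroup F] [NormedSpace ℂ F] [NormedAddCommGroup G] [NormedSpace ℂ G]

theorem ProjTensor.norm_lift_le [CompleteSpace G] (f : E →L[ℂ] F →L[ℂ] G) (x : ProjTensor E F) :
    ‖ProjTensor.lift f x‖ ≤ ‖f‖ * ‖x‖ := by
  induction x using Completion.induction_on with
  | hp => exact isClosed_le (by fun_prop) (by fun_prop)
  | ih z =>
    rw [ProjTensor.lift_coe, Completion.norm_coe]
    exact ContinuousLinearMap.le_of_opNorm_le _
      (LinearMap.mkContinuous_norm_le _ (norm_nonneg f) _) z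

theorem ProjTensor.norm_mk_le (x : E) (y : F) : ‖ProjTensor.mk x y‖ ≤ ‖x‖ * ‖y‖ := by
  have h := projNorm_le [(x, y)]
  have h1 : listTensor [(x, y)] = AlgTensor.mk x y := add_zero _
  have h2 : listCost [(x, y)] = ‖x‖ * ‖y‖ := add_zero _
  rw [h1, h2] at h
  exact (Completion.norm_coe _).trans_le h

variable (E F) in
/-- `(x, y) ↦ x ⊗ y` as a bounded bilinear map into the projective tensor product. -/
noncomputable def ProjTensor.mkL : E →L[ℂ] F →L[ℂ] ProjTensor E F :=
  LinearMap.mkContinuous₂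
    (LinearMap.mk₂ ℂ (fun (x : E) (y : F) => ProjTensor.mk x y)
      (fun x x' y => (congrArg _ (TensorProduct.add_tmul x x' y)).trans (Completion.coe_add _ _))
      (fun c x y => Completion.coe_smul c (AlgTensor.mk x y))
      (fun x y y' => (congrArg _ (TensorProduct.tmul_add x y y')).trans (Completion.coe_add _ _))
      (fun c x y => (congrArg _ (TensorProduct.tmul_smul c x y)).trans
        (Completion.coe_smul c (AlgTensor.mk x y)))) 1
    fun x y => by rw [one_mul]; exact ProjTensor.norm_mk_le x y

theorem ProjTensor.mkL_apply (x : E) (y : F) : ProjTensor.mkL E F x y = ProjTensor.mk x y := rfl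

@[elab_as_elim]
theorem ProjTensor.induction {p : ProjTensor E F → Prop} (x : ProjTensor E F)
    (closed : IsClosed {x | p x}) (add : ∀ x y, p x → p y → p (x + y))
    (mk : ∀ x y, p (ProjTensor.mk x y)) : p x := by
  induction x using Completion.induction_on with
  | hp => exact closed
  | ih z =>
    induction z using TensorProduct.induction_on with
    | zero =>
      have h := mk 0 0
      rwa [← ProjTensor.mkL_apply, map_zero] at h
    | tmul x y => exact mk x y
    | add z w hz hw => exact (Completion.coe_add (α := AlgTensor E F) z w).symm ▸ add _ _ hz hw

end Projective

/-! ### Rank one operators in the trace class -/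

section RankOne

variable {H : Type*} [NormedAddCommGroup H] [InnerProductSpace ℂ H]

theorem nuclearRep_rankOne (u v : H) :
    NuclearRep (InnerProductSpace.rankOne ℂ u v) (Pi.single (M := fun _ => H) 0 u)
      (Pi.single (M := fun _ => H) 0 v) where
  summable := summable_of_ne_finset_zero (s := {0}) fun n hn => by
    rw [Pi.single_eq_of_ne (by simpa using hn), norm_zero, zero_mul]
  hasSum x := by
    convert hasSum_single 0 fun n hn => ?_ using 1
    · simp
    · simp [Pi.single_eq_of_ne hn]

/-- The rank one operator `x ↦ ⟪v, x⟫ u` as a trace class operator. -/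
noncomputable def TraceClass.rankOne (u v : H) : TraceClass H :=
  ⟨InnerProductSpace.rankOne ℂ u v, _, _, nuclearRep_rankOne u v⟩

theorem TraceClass.op_rankOne (u v : H) :
    (TraceClass.rankOne u v).op = InnerProductSpace.rankOne ℂ u v := rfl

theorem TraceClass.op_injective : Function.Injective (TraceClass.op : TraceClass H → H →L[ℂ] H) :=
  Subtype.val_injective

theorem TraceClass.rankOne_add_left (u u' v : H) :
    rankOne (u + u') v = rankOne u v + rankOne u' v :=
  op_injective (by
    change _ = (rankOne u v).op + (rankOne u' v).op
    simp [op_rankOne])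

theorem TraceClass.rankOne_add_right (u v v' : H) :
    rankOne u (v + v') = rankOne u v + rankOne u v' :=
  op_injective (by
    change _ = (rankOne u v).op + (rankOne u v').op
    simp [op_rankOne])

theorem TraceClass.rankOne_smul_left (c : ℂ) (u v : H) :
    rankOne (c • u) v = c • rankOne u v :=
  op_injective (by
    change _ = c • (rankOne u v).op
    simp [op_rankOne])

theorem TraceClass.rankOne_smul_right (c : ℂ) (u v : H) :
    rankOne u (c • v) = starRingEnd ℂ c • rankOne u v :=
  op_injective (by
    change _ = starRingEnd ℂ c • (rankOne u v).op
    simp [op_rankOne])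

variable [CompleteSpace H]

/-- A nuclear representation of a trace class operator converges in the trace norm. -/
theorem NuclearRep.tendsto_sum_rankOne {b : TraceClass H} {ξ η : ℕ → H}
    (h : NuclearRep b.op ξ η) :
    Tendsto (fun N => ∑ n ∈ Finset.range N, TraceClass.rankOne (ξ n) (η n)) atTop (𝓝 b) := by
  rw [tendsto_iff_norm_sub_tendsto_zero]
  have htail := tendsto_sum_nat_add (fun n => ‖ξ n‖ * ‖η n‖)
  refine squeeze_zero (fun _ => norm_nonneg _) (fun N => ?_) htail
  have hop : ∀ N, (∑ n ∈ Finset.range N, TraceClass.rankOne (ξ n) (η n)).op =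
      ∑ n ∈ Finset.range N, InnerProductSpace.rankOne ℂ (ξ n) (η n) :=
    fun N => map_sum (TraceClass.incl H) _ _
  have hrep : NuclearRep (b - ∑ n ∈ Finset.range N, TraceClass.rankOne (ξ n) (η n)).op
      (fun n => ξ (n + N)) (fun n => η (n + N)) :=
    { summable := (summable_nat_add_iff N).mpr h.summable
      hasSum := fun x => by
        have e : (b - ∑ n ∈ Finset.range N, TraceClass.rankOne (ξ n) (η n)).op x =
            b.op x - ∑ n ∈ Finset.range N, ⟪η n, x⟫_ℂ • ξ n := by
          change (b.op - (∑ n ∈ Finset.range N, TraceClass.rankOne (ξ n) (η n)).op) x = _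
          rw [hop]
          simp
        rw [e]
        exact (hasSum_nat_add_iff' N).mpr (h.hasSum x) }
  rw [norm_sub_rev]
  exact traceNorm_le hrep

variable {E : Type*} [NormedAddCommGroup E] [NormedSpace ℂ E]

variable (H E) in
/-- The linear span of the tensors `a ⊗ b` with `b` of rank one, a dense subspace of
`E ⊗̂ 𝒯(H)`. -/
noncomputable def finiteRankTensors : Submodule ℂ (ProjTensor E (TraceClass H)) :=
  Submodule.span ℂ {x | ∃ a u v, x = ProjTensor.mk a (TraceClass.rankOne u v)}

theorem mk_rankOne_mem (a : E) (u v : H) :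
    ProjTensor.mk a (TraceClass.rankOne u v) ∈ finiteRankTensors H E :=
  Submodule.subset_span ⟨a, u, v, rfl⟩

@[elab_as_elim]
theorem finiteRankTensors_induction {p : ProjTensor E (TraceClass H) → Prop}
    {x : ProjTensor E (TraceClass H)} (hx : x ∈ finiteRankTensors H E)
    (add : ∀ x y, p x → p y → p (x + y))
    (mk : ∀ a u v, p (ProjTensor.mk a (TraceClass.rankOne u v))) : p x := by
  induction hx using Submodule.closure_induction with
  | zero =>
    have h := mk 0 0 0
    rwa [← ProjTensor.mkL_apply, map_zero] at h
  | add x y _ _ hx hy => exact add x y hx hy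
  | smul_mem c x hx =>
    obtain ⟨a, u, v, rfl⟩ := hx
    have h := mk (c • a) u v
    rwa [← ProjTensor.mkL_apply, map_smul] at h

theorem dense_finiteRankTensors (x : ProjTensor E (TraceClass H)) :
    x ∈ closure (finiteRankTensors H E : Set (ProjTensor E (TraceClass H))) := by
  rw [← Submodule.topologicalClosure_coe, SetLike.mem_coe]
  induction x using ProjTensor.induction with
  | closed => exact Submodule.isClosed_topologicalClosure _
  | add x y hx hy => exact add_mem hx hy
  | mk a b =>
    obtain ⟨ξ, η, h⟩ := b.exists_rep
    have hlim := ((ProjTensor.mkL E (TraceClass H) a).continuous.tendsto b).comp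
      h.tendsto_sum_rankOne
    refine (Submodule.isClosed_topologicalClosure _).mem_of_tendsto hlim (.of_forall fun N => ?_)
    rw [Function.comp_apply, map_sum]
    exact sum_mem fun n _ => Submodule.le_topologicalClosure _ (mk_rankOne_mem _ _ _)

/-- Principle of induction on `E ⊗̂ 𝒯(H)` from the tensors `a ⊗ b` with `b` of rank one. -/
@[elab_as_elim]
theorem ProjTensor.induction_rankOne {p : ProjTensor E (TraceClass H) → Prop}
    (x : ProjTensor E (TraceClass H)) (closed : IsClosed {x | p x})
    (add : ∀ x y, p x → p y → p (x + y))
    (mk : ∀ a u v, p (ProjTensor.mk a (TraceClass.rankOne u v))) : p x :=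
  closure_minimal (t := {x | p x})
    (fun _ hy => finiteRankTensors_induction (p := p) hy add mk) closed
    (dense_finiteRankTensors x)

end RankOne

/-! ### Accretive operators -/

section Accretive

variable {V : Type*} [NormedAddCommGroup V] [InnerProductSpace ℂ V]

/-- An operator is accretive if the real part of its quadratic form is nonnegative. Unlike
positivity this does not require the operator to be hermitian, so that an arbitrary operator becomes
accretive when a multiple of the identity is added. -/
def Accretive (T : V →L[ℂ] V) : Prop := ∀ ζ, 0 ≤ (⟪ζ, T ζ⟫_ℂ).re

theorem nonneg_iff_forall_inner {T : V →L[ℂ] V} : 0 ≤ T ↔ ∀ ζ, 0 ≤ ⟪ζ, T ζ⟫_ℂ := by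
  rw [ContinuousLinearMap.nonneg_iff_isPositive, ContinuousLinearMap.isPositive_iff_complex]
  refine forall_congr' fun ζ => ?_
  rw [← inner_conj_symm ζ, ← Complex.star_def, star_nonneg_iff, Complex.nonneg_iff, Complex.ext_iff]
  simp [and_comm]

theorem Complex.nonneg_iff_forall_mul_I {z : ℂ} :
    0 ≤ z ↔ 0 ≤ z.re ∧ 0 ≤ (Complex.I * z).re ∧ 0 ≤ (-Complex.I * z).re := by
  rw [Complex.nonneg_iff]
  simp only [Complex.mul_re, Complex.I_re, Complex.I_im, zero_mul, one_mul, zero_sub,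
    Complex.neg_re, neg_mul, neg_neg]
  constructor
  · rintro ⟨h1, h2⟩
    simp [h1, ← h2]
  · rintro ⟨h1, h2, h3⟩
    exact ⟨h1, by linarith⟩

theorem accretive_of_nonneg {T : V →L[ℂ] V} (h : 0 ≤ T) : Accretive T := fun ζ =>
  (Complex.nonneg_iff.mp (nonneg_iff_forall_inner.mp h ζ)).1

theorem accretive_smul_I_of_nonneg {T : V →L[ℂ] V} (h : 0 ≤ T) : Accretive (Complex.I • T) :=
  fun ζ => by
    simpa using (Complex.nonneg_iff_forall_mul_I.mp (nonneg_iff_forall_inner.mp h ζ)).2.1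

theorem accretive_smul_neg_I_of_nonneg {T : V →L[ℂ] V} (h : 0 ≤ T) :
    Accretive (-Complex.I • T) :=
  fun ζ => by
    simpa using (Complex.nonneg_iff_forall_mul_I.mp (nonneg_iff_forall_inner.mp h ζ)).2.2

theorem Accretive.add {S T : V →L[ℂ] V} (hS : Accretive S) (hT : Accretive T) :
    Accretive (S + T) := fun ζ => by
  simpa [inner_add_right] using add_nonneg (hS ζ) (hT ζ)

/-- A linear functional with nonnegative real part on the vectors that a linear map `Φ` takes to
accretive operators is nonnegative on those that `Φ` takes to positive operators. -/
theorem nonneg_of_re_nonneg {E : Type*} [AddCommGroup E] [Module ℂ E] (Φ : E →ₗ[ℂ] (V →L[ℂ] V))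
    (s : E →ₗ[ℂ] ℂ) (h : ∀ x, Accretive (Φ x) → 0 ≤ (s x).re) (x : E) (hx : 0 ≤ Φ x) :
    0 ≤ s x := by
  rw [Complex.nonneg_iff_forall_mul_I]
  refine ⟨h x (accretive_of_nonneg hx), ?_, ?_⟩
  · rw [← smul_eq_mul, ← map_smul]
    refine h _ ?_
    rw [map_smul]
    exact accretive_smul_I_of_nonneg hx
  · rw [← smul_eq_mul, ← map_smul]
    refine h _ ?_
    rw [map_smul]
    exact accretive_smul_neg_I_of_nonneg hx

end Accretive

/-! ### Slices of the Hilbert space tensor product -/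

section Slices

variable {K H : Type*} [NormedAddCommGroup K] [InnerProductSpace ℂ K]
  [NormedAddCommGroup H] [InnerProductSpace ℂ H]

/-- The bounded operator `k ↦ k ⊗ u` from `K` to `K ⊗ H`. -/
noncomputable def tensorRight (u : H) : K →L[ℂ] HilbertTensor K H :=
  (Completion.toComplL : K ⊗[ℂ] H →L[ℂ] HilbertTensor K H).comp <|
    LinearMap.mkContinuous ((TensorProduct.mk ℂ K H).flip u) ‖u‖ fun k => by
      simp [TensorProduct.norm_tmul, mul_comm]

theorem tensorRight_apply (u : H) (k : K) :
    tensorRight u k = ((k ⊗ₜ[ℂ] u : K ⊗[ℂ] H) : HilbertTensor K H) := rfl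

theorem inner_tensorRight (u v : H) (k l : K) :
    ⟪tensorRight u k, tensorRight v l⟫_ℂ = ⟪k, l⟫_ℂ * ⟪u, v⟫_ℂ := by
  rw [tensorRight_apply, tensorRight_apply, Completion.inner_coe, TensorProduct.inner_tmul]

theorem opTensor_tensorRight (a : K →L[ℂ] K) (b : H →L[ℂ] H) (u : H) (k : K) :
    opTensor a b (tensorRight u k) = tensorRight (b u) (a k) := by
  rw [tensorRight_apply, opTensor_coe]
  rfl

theorem hilbertTensor_clm_ext {W : Type*} [NormedAddCommGroup W] [NormedSpace ℂ W]
    {S T : HilbertTensor K H →L[ℂ] W}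
    (h : ∀ u k, S (tensorRight u k) = T (tensorRight u k)) : S = T := by
  ext z
  induction z using Completion.induction_on with
  | hp => exact isClosed_eq S.continuous T.continuous
  | ih z =>
    induction z using TensorProduct.induction_on with
    | zero => rw [Completion.coe_zero, map_zero, map_zero]
    | tmul k u => exact h u k
    | add z w hz hw => rw [Completion.coe_add, map_add, map_add, hz, hw]

variable [CompleteSpace K] [CompleteSpace H]

theorem adjoint_tensorRight (u v : H) (k : K) :
    ContinuousLinearMap.adjoint (tensorRight v) (tensorRight u k) = ⟪v, u⟫_ℂ • k := by
  refine ext_inner_left ℂ fun l => ?_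
  rw [ContinuousLinearMap.adjoint_inner_right, inner_tensorRight, inner_smul_right, mul_comm]

theorem opTensor_rankOne (a : K →L[ℂ] K) (u v : H) :
    opTensor a (InnerProductSpace.rankOne ℂ u v) =
      tensorRight u ∘L a ∘L ContinuousLinearMap.adjoint (tensorRight v) := by
  refine hilbertTensor_clm_ext fun w k => ?_
  rw [opTensor_tensorRight, ContinuousLinearMap.comp_apply, ContinuousLinearMap.comp_apply,
    adjoint_tensorRight, map_smul, map_smul, InnerProductSpace.rankOne_apply]
  rw [tensorRight_apply, tensorRight_apply, TensorProduct.tmul_smul, Completion.coe_smul]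

theorem inner_opTensor_rankOne (a : K →L[ℂ] K) (u v : H) (ζ : HilbertTensor K H) :
    ⟪ζ, opTensor a (InnerProductSpace.rankOne ℂ u v) ζ⟫_ℂ =
      ⟪ContinuousLinearMap.adjoint (tensorRight u) ζ,
        a (ContinuousLinearMap.adjoint (tensorRight v) ζ)⟫_ℂ := by
  rw [opTensor_rankOne, ContinuousLinearMap.adjoint_inner_left]
  rfl

end Slices

/-! ### The transpose on the projective tensor product -/

section Transpose

variable {H ι : Type*} [NormedAddCommGroup H] [InnerProductSpace ℂ H] [CompleteSpace H]
  (e : HilbertBasis ι ℂ H)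

theorem inner_conjL_right (x y : H) : ⟪x, conjL e y⟫_ℂ = ⟪y, conjL e x⟫_ℂ := by
  rw [← inner_conj_symm, inner_conjL, inner_conj_symm]

theorem conjL_basis (i : ι) : conjL e (e i) = e i := by
  classical
  rw [conjL_apply, e.repr_self]
  have : star (lp.single 2 i (1 : ℂ)) = lp.single (E := fun _ : ι => ℂ) 2 i (1 : ℂ) := by
    ext m
    by_cases hm : m = i
    · subst hm; simp
    · simp [lp.single_apply, hm]
  rw [this, e.repr_symm_single]

theorem inner_transpose_apply (b : H →L[ℂ] H) (x y : H) :
    ⟪x, transpose e b y⟫_ℂ = ⟪conjL e y, b (conjL e x)⟫_ℂ := by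
  rw [transpose_apply, inner_conjL_right, ContinuousLinearMap.adjoint_inner_left]

theorem transpose_transpose (b : H →L[ℂ] H) : transpose e (transpose e b) = b := by
  ext y
  refine ext_inner_left ℂ fun x => ?_
  rw [inner_transpose_apply, inner_transpose_apply, conjL_conjL, conjL_conjL]

theorem transpose_rankOne (u v : H) :
    transpose e (InnerProductSpace.rankOne ℂ u v) =
      InnerProductSpace.rankOne ℂ (conjL e v) (conjL e u) := by
  ext y
  refine ext_inner_left ℂ fun x => ?_
  rw [inner_transpose_apply]
  simp [inner_smul_right, inner_conjL_right e x, inner_conjL e u y, mul_comm]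

theorem transpose_mem_traceClassSubmodule (b : TraceClass H) :
    transpose e b.op ∈ traceClassSubmodule H := by
  obtain ⟨ξ, η, h⟩ := b.exists_rep
  exact ⟨_, _, h.transpose e⟩

/-- The transpose as a bounded map on the space of trace class operators with the trace norm. -/
noncomputable def transposeTraceClass : TraceClass H →L[ℂ] TraceClass H :=
  LinearMap.mkContinuous
    { toFun := fun b => ⟨transpose e b.op, transpose_mem_traceClassSubmodule e b⟩
      map_add' := fun b c => TraceClass.op_injective (map_add (transpose e) b.op c.op)
      map_smul' := fun c b => TraceClass.op_injective (map_smul (transpose e) c b.op) } 1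
    fun b => by
      rw [one_mul]
      refine le_traceNorm b _ fun ξ η h => ?_
      refine (traceNorm_le (b := ⟨transpose e b.op, _⟩) (h.transpose e)).trans (le_of_eq ?_)
      simp only [norm_conjL, mul_comm]

theorem transposeTraceClass_rankOne (u v : H) :
    transposeTraceClass e (.rankOne u v) = .rankOne (conjL e v) (conjL e u) :=
  TraceClass.op_injective (transpose_rankOne e u v)

variable {K : Type*} [NormedAddCommGroup K] [InnerProductSpace ℂ K] [CompleteSpace K]
  {A : Submodule ℂ (K →L[ℂ] K)}

/-- The partial transpose `ι ⊗ t` as a map of `A ⊗̂ 𝒯(H)` into itself. -/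
noncomputable def partialTranspose :
    ProjTensor A (TraceClass H) →L[ℂ] ProjTensor A (TraceClass H) :=
  ProjTensor.lift ((ProjTensor.mkL A (TraceClass H)).bilinearComp (.id ℂ A)
    (transposeTraceClass e))

theorem partialTranspose_mk (a : A) (b : TraceClass H) :
    partialTranspose e (ProjTensor.mk a b) = ProjTensor.mk a (transposeTraceClass e b) :=
  ProjTensor.lift_mk _ a b

theorem partialTranspose_mem {x : ProjTensor A (TraceClass H)} (hx : x ∈ finiteRankTensors H A) :
    partialTranspose e x ∈ finiteRankTensors H A := by
  refine finiteRankTensors_induction hx (fun x y hx hy => ?_) (fun a u v => ?_)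
  · rw [map_add]
    exact add_mem hx hy
  · rw [partialTranspose_mk, transposeTraceClass_rankOne]
    exact mk_rankOne_mem _ _ _

theorem partialTranspose_partialTranspose (x : ProjTensor A (TraceClass H)) :
    partialTranspose e (partialTranspose e x) = x := by
  induction x using ProjTensor.induction_rankOne with
  | closed => exact isClosed_eq (by fun_prop) continuous_id
  | add x y hx hy => rw [map_add, map_add, hx, hy]
  | mk a u v =>
    simp only [partialTranspose_mk, transposeTraceClass_rankOne, conjL_conjL]

/-- The quadratic form of `(ι ⊗ id)(a ⊗ |u⟩⟨v|)`. -/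
theorem inner_idTensor_mk_rankOne (a : A) (u v : H) (ζ : HilbertTensor K H) :
    ⟪ζ, idTensor (.id ℂ (H →L[ℂ] H)) (ProjTensor.mk a (.rankOne u v)) ζ⟫_ℂ =
      ⟪ContinuousLinearMap.adjoint (tensorRight u) ζ,
        (a : K →L[ℂ] K) (ContinuousLinearMap.adjoint (tensorRight v) ζ)⟫_ℂ := by
  rw [idTensor_mk]
  exact inner_opTensor_rankOne _ _ _ _

theorem idTensor_partialTranspose (x : ProjTensor A (TraceClass H)) :
    idTensor (.id ℂ (H →L[ℂ] H)) (partialTranspose e x) = idTensor (transpose e) x := by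
  induction x using ProjTensor.induction with
  | closed => exact isClosed_eq (by fun_prop) (by fun_prop)
  | add x y hx hy => rw [map_add, map_add, map_add, hx, hy]
  | mk a b =>
    rw [partialTranspose_mk, idTensor_mk, idTensor_mk]
    rfl

theorem dualFunctional_mk_rankOne (φ : A →L[ℂ] (H →L[ℂ] H)) (a : A) (u v : H) :
    dualFunctional e φ (ProjTensor.mk a (.rankOne u v)) = ⟪conjL e u, φ a (conjL e v)⟫_ℂ := by
  rw [dualFunctional_mk, TraceClass.op_rankOne, transpose_rankOne, trace,
    (((nuclearRep_rankOne (conjL e v) (conjL e u)).comp_left (φ a)).hasSum_trace e).tsum_eq,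
    tsum_eq_single 0 fun n hn => by simp [Pi.single_eq_of_ne hn]]
  simp

theorem dualFunctional_partialTranspose (φ : A →L[ℂ] (H →L[ℂ] H))
    (x : ProjTensor A (TraceClass H)) :
    dualFunctional e φ (partialTranspose e x) = dualFunctional e ((transpose e).comp φ) x := by
  induction x using ProjTensor.induction_rankOne with
  | closed => exact isClosed_eq (by fun_prop) (by fun_prop)
  | add x y hx hy => rw [map_add, map_add, map_add, hx, hy]
  | mk a u v =>
    rw [partialTranspose_mk, transposeTraceClass_rankOne, dualFunctional_mk_rankOne,
      dualFunctional_mk_rankOne, ContinuousLinearMap.comp_apply, inner_transpose_apply]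

theorem norm_dualFunctional_le (φ : A →L[ℂ] (H →L[ℂ] H)) (x : ProjTensor A (TraceClass H)) :
    ‖dualFunctional e φ x‖ ≤ ‖φ‖ * ‖x‖ := by
  refine (ProjTensor.norm_lift_le _ x).trans ?_
  gcongr
  exact LinearMap.mkContinuous₂_norm_le _ (norm_nonneg φ) _

theorem dualFunctional_add (φ ψ : A →L[ℂ] (H →L[ℂ] H)) (x : ProjTensor A (TraceClass H)) :
    dualFunctional e (φ + ψ) x = dualFunctional e φ x + dualFunctional e ψ x := by
  induction x using ProjTensor.induction_rankOne with
  | closed => exact isClosed_eq (by fun_prop) (by fun_prop)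
  | add x y hx hy => rw [map_add, map_add, map_add, hx, hy]; ring
  | mk a u v => simp only [dualFunctional_mk_rankOne, add_apply, inner_add_right]

end Transpose

/-! ### Completely positive maps and approximately accretive matrices -/

section CompletelyPositive

variable {K H : Type*} [NormedAddCommGroup K] [InnerProductSpace ℂ K] [CompleteSpace K]
  [NormedAddCommGroup H] [InnerProductSpace ℂ H] [CompleteSpace H]
  {A : Submodule ℂ (K →L[ℂ] K)} {φ : A →L[ℂ] (H →L[ℂ] H)}

theorem IsCompletelyPositive.isPositiveMap (hφ : IsCompletelyPositive φ) : IsPositiveMap φ := by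
  intro a ha
  rw [nonneg_iff_forall_inner] at ha ⊢
  intro ζ
  have h := hφ 1 (Matrix.of fun _ _ => a) (fun ξ => by simpa using ha (ξ 0)) (fun _ => ζ)
  simpa using h

theorem IsPositiveMap.isSelfAdjoint_map (hA : IsOperatorSystem A) (hφ : IsPositiveMap φ) (a : A)
    (ha : IsSelfAdjoint (a : K →L[ℂ] K)) : IsSelfAdjoint (φ a) := by
  have h1 : IsSelfAdjoint (φ ⟨1, hA.one_mem⟩) := IsSelfAdjoint.of_nonneg (hφ _ zero_le_one)
  have h2 : 0 ≤ φ (a + (‖(a : K →L[ℂ] K)‖ : ℂ) • ⟨1, hA.one_mem⟩) := by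
    refine hφ _ ?_
    have h := ha.neg_algebraMap_norm_le_self
    rw [neg_le_iff_add_nonneg] at h
    convert h using 2
    ext x
    simp [Algebra.algebraMap_eq_smul_one]
  have h3 : IsSelfAdjoint ((‖(a : K →L[ℂ] K)‖ : ℂ) • φ ⟨1, hA.one_mem⟩) :=
    IsSelfAdjoint.smul (by simp [isSelfAdjoint_iff]) h1
  have h4 := (IsSelfAdjoint.of_nonneg h2).sub h3
  rwa [map_add, map_smul, add_sub_cancel_right] at h4

theorem IsPositiveMap.map_star (hA : IsOperatorSystem A) (hφ : IsPositiveMap φ) (a : A) :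
    φ ⟨star a, hA.star_mem a a.2⟩ = star (φ a) := by
  set b : A := ⟨star a, hA.star_mem a a.2⟩ with hb
  have h1 := hφ.isSelfAdjoint_map hA (a + b) (IsSelfAdjoint.add_star_self (a : K →L[ℂ] K))
  have h2 := hφ.isSelfAdjoint_map hA (Complex.I • (a - b)) (by
    rw [isSelfAdjoint_iff]
    change star (Complex.I • ((a : K →L[ℂ] K) - star (a : K →L[ℂ] K))) =
      Complex.I • ((a : K →L[ℂ] K) - star (a : K →L[ℂ] K))
    rw [star_smul, star_sub, star_star, Complex.star_def, Complex.conj_I, neg_smul, ← smul_neg,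
      neg_sub])
  rw [isSelfAdjoint_iff, map_add, star_add] at h1
  rw [isSelfAdjoint_iff, map_smul, map_sub, star_smul, star_sub, Complex.star_def, Complex.conj_I,
    neg_smul, ← smul_neg, neg_sub] at h2
  have h3 : star (φ b) - star (φ a) = φ a - φ b := smul_right_injective _ Complex.I_ne_zero h2
  have h4 : (2 : ℂ) • φ b = (2 : ℂ) • star (φ a) := by
    have h5 : (2 : ℂ) • φ b = (φ a + φ b) - (φ a - φ b) := by rw [two_smul]; abel
    rw [h5, ← h1, ← h3, two_smul]
    abel
  exact smul_right_injective _ two_ne_zero h4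

/-- The quadratic form of the hermitian matrix `M + M* + c (δᵢⱼ T)`. -/
theorem sum_inner_add_star {V : Type*} [NormedAddCommGroup V] [InnerProductSpace ℂ V]
    [CompleteSpace V] {n : ℕ} (M : Matrix (Fin n) (Fin n) (V →L[ℂ] V)) (T : V →L[ℂ] V) (c : ℂ)
    (ξ : Fin n → V) :
    ∑ i, ∑ j, ⟪ξ i, (M i j + star (M j i) + if i = j then c • T else 0) (ξ j)⟫_ℂ =
      (2 * (∑ i, ∑ j, ⟪ξ i, M i j (ξ j)⟫_ℂ).re : ℝ) + c * ∑ i, ⟪ξ i, T (ξ i)⟫_ℂ := by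
  have h1 : ∑ i, ∑ j, ⟪ξ i, star (M j i) (ξ j)⟫_ℂ =
      starRingEnd ℂ (∑ i, ∑ j, ⟪ξ i, M i j (ξ j)⟫_ℂ) := by
    rw [Finset.sum_comm]
    simp only [map_sum, inner_conj_symm]
    refine Finset.sum_congr rfl fun i _ => Finset.sum_congr rfl fun j _ => ?_
    rw [ContinuousLinearMap.star_eq_adjoint, ContinuousLinearMap.adjoint_inner_right]
  have h2 : ∀ i j, ⟪ξ i, (if i = j then c • T else 0 : V →L[ℂ] V) (ξ j)⟫_ℂ =
      if i = j then c * ⟪ξ i, T (ξ i)⟫_ℂ else 0 := fun i j => by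
    split_ifs with h
    · subst h; simp
    · simp
  simp only [add_apply, inner_add_right, Finset.sum_add_distrib, h1, h2,
    Finset.sum_ite_eq, Finset.mem_univ, if_true, Finset.mul_sum]
  rw [Complex.add_conj]

/-- Complete positivity in a form which is stable under small perturbations of the matrix. -/
theorem IsCompletelyPositive.re_sum_inner_ge (hA : IsOperatorSystem A)
    (hφ : IsCompletelyPositive φ) {n : ℕ} (m : Matrix (Fin n) (Fin n) A) (ε : ℝ)
    (hm : ∀ ξ : Fin n → K,
      -ε * ∑ i, ‖ξ i‖ ^ 2 ≤ (∑ i, ∑ j, ⟪ξ i, (m i j : K →L[ℂ] K) (ξ j)⟫_ℂ).re)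
    (η : Fin n → H) :
    -ε * (∑ i, ⟪η i, φ ⟨1, hA.one_mem⟩ (η i)⟫_ℂ).re ≤
      (∑ i, ∑ j, ⟪η i, φ (m i j) (η j)⟫_ℂ).re := by
  let m' : Matrix (Fin n) (Fin n) A := fun i j =>
    m i j + ⟨star (m j i : K →L[ℂ] K), hA.star_mem _ (m j i).2⟩ +
      if i = j then ((2 * ε : ℝ) : ℂ) • ⟨1, hA.one_mem⟩ else 0
  have hm' : MatrixPositive (m'.map fun a => (a : K →L[ℂ] K)) := by
    intro ξ
    have h := sum_inner_add_star (m.map fun a => (a : K →L[ℂ] K)) 1 ((2 * ε : ℝ) : ℂ) ξ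
    have h1 : ∀ i j, (m'.map fun a => (a : K →L[ℂ] K)) i j =
        (m.map fun a => (a : K →L[ℂ] K)) i j + star ((m.map fun a => (a : K →L[ℂ] K)) j i) +
          if i = j then ((2 * ε : ℝ) : ℂ) • 1 else 0 := fun i j => by
      change ((m' i j : A) : K →L[ℂ] K) = _
      simp only [Matrix.map_apply, m']
      split_ifs <;> simp
    simp only [h1, h]
    have h2 : ∀ i, ⟪ξ i, (1 : K →L[ℂ] K) (ξ i)⟫_ℂ = ((‖ξ i‖ ^ 2 : ℝ) : ℂ) := fun i => by
      rw [one_apply_eq_self, inner_self_eq_norm_sq_to_K]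
      simp
    simp only [h2, ← Complex.ofReal_sum, ← Complex.ofReal_mul, ← Complex.ofReal_add,
      Complex.zero_le_real]
    have h3 := hm ξ
    simp only [Matrix.map_apply]
    linarith
  have h := hφ n m' hm' η
  have h1 : ∀ i j, (m'.map φ) i j = (m.map φ) i j + star ((m.map φ) j i) +
      if i = j then ((2 * ε : ℝ) : ℂ) • φ ⟨1, hA.one_mem⟩ else 0 := fun i j => by
    change φ (m' i j) = _
    simp only [Matrix.map_apply, m', map_add, hφ.isPositiveMap.map_star hA]
    split_ifs
    · rw [map_smul]
    · rw [map_zero]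
  simp only [h1, sum_inner_add_star] at h
  have h2 := (Complex.nonneg_iff.mp h).1
  rw [Complex.add_re, Complex.ofReal_re, Complex.re_ofReal_mul] at h2
  simp only [Matrix.map_apply] at h2
  linarith

end CompletelyPositive

/-! ### Truncation to finitely many basis vectors -/

section Truncation

/-- Pointwise convergence of a uniformly Lipschitz family takes place on a closed set. -/
theorem isClosed_setOf_tendsto_of_lipschitz {X I : Type*} [SeminormedAddCommGroup X] {l : Filter I}
    {F : I → X → ℂ} {f : X → ℂ} {r : ℝ} (hF : ∀ᶠ i in l, ∀ x y, ‖F i x - F i y‖ ≤ r * ‖x - y‖)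
    (hf : ∀ x y, ‖f x - f y‖ ≤ r * ‖x - y‖) :
    IsClosed {x | Tendsto (fun i => F i x) l (𝓝 (f x))} := by
  refine isClosed_of_closure_subset fun x hx => ?_
  change Tendsto (fun i => F i x) l (𝓝 (f x))
  rw [Metric.tendsto_nhds]
  intro ε hε
  have hr : 0 < |r| + 1 := by positivity
  obtain ⟨y, hy, hxy⟩ := Metric.mem_closure_iff.mp hx (ε / 3 / (|r| + 1)) (by positivity)
  rw [dist_eq_norm, lt_div_iff₀ hr] at hxy
  have hrxy : r * ‖x - y‖ < ε / 3 := by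
    refine lt_of_le_of_lt ?_ hxy
    rw [mul_comm]
    exact mul_le_mul_of_nonneg_left (by linarith [le_abs_self r]) (norm_nonneg _)
  filter_upwards [hF, Metric.tendsto_nhds.mp hy (ε / 3) (by positivity)] with i hi hiy
  have h1 := hi x y
  have h2 := hf y x
  rw [norm_sub_rev y x] at h2
  rw [← dist_eq_norm] at h1 h2
  linarith [dist_triangle4 (F i x) (F i y) (f y) (f x)]

variable {K H ι : Type*} [NormedAddCommGroup K] [InnerProductSpace ℂ K] [CompleteSpace K]
  [NormedAddCommGroup H] [InnerProductSpace ℂ H] [CompleteSpace H] (e : HilbertBasis ι ℂ H)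
  {A : Submodule ℂ (K →L[ℂ] K)}

/-- The orthogonal projection onto the span of finitely many basis vectors. -/
noncomputable def basisProj (s : Finset ι) : H →L[ℂ] H :=
  ∑ i ∈ s, InnerProductSpace.rankOne ℂ (e i) (e i)

theorem basisProj_apply (s : Finset ι) (x : H) :
    basisProj e s x = ∑ i ∈ s, ⟪e i, x⟫_ℂ • e i := by
  simp [basisProj]

theorem norm_basisProj_le (s : Finset ι) : ‖basisProj e s‖ ≤ 1 := by
  refine ContinuousLinearMap.opNorm_le_bound _ zero_le_one fun x => ?_
  rw [one_mul, ← sq_le_sq₀ (norm_nonneg _) (norm_nonneg _), basisProj_apply]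
  have h : ‖∑ i ∈ s, ⟪e i, x⟫_ℂ • e i‖ ^ 2 = ∑ i ∈ s, ‖⟪e i, x⟫_ℂ‖ ^ 2 := by
    have h1 := e.orthonormal.inner_sum (fun i => ⟪e i, x⟫_ℂ) (fun i => ⟪e i, x⟫_ℂ) s
    rw [inner_self_eq_norm_sq_to_K] at h1
    have h2 : ∀ i, starRingEnd ℂ ⟪e i, x⟫_ℂ * ⟪e i, x⟫_ℂ =
        ((‖⟪e i, x⟫_ℂ‖ ^ 2 : ℝ) : ℂ) := fun i => by
      rw [mul_comm, Complex.mul_conj, Complex.normSq_eq_norm_sq]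
    simp only [h2, ← Complex.ofReal_sum] at h1
    exact Complex.ofReal_injective ((Complex.ofReal_pow _ _).trans h1)
  rw [h]
  exact e.orthonormal.sum_inner_products_le x

theorem tendsto_basisProj (x : H) : Tendsto (fun s => basisProj e s x) atTop (𝓝 x) := by
  have h := e.hasSum_repr x
  simp only [e.repr_apply_apply] at h
  simpa only [HasSum, SummationFilter.unconditional_filter, basisProj_apply] using h

/-- The compression `a ↦ P φ(a) P` of a map `φ : A → B(H)`. -/
noncomputable def compress (P : H →L[ℂ] H) (φ : A →L[ℂ] (H →L[ℂ] H)) : A →L[ℂ] (H →L[ℂ] H) :=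
  ((ContinuousLinearMap.compL ℂ H H H P).comp ((ContinuousLinearMap.compL ℂ H H H).flip P)).comp φ

theorem compress_apply (P : H →L[ℂ] H) (φ : A →L[ℂ] (H →L[ℂ] H)) (a : A) (x : H) :
    compress P φ a x = P (φ a (P x)) := rfl

theorem norm_compress_le {P : H →L[ℂ] H} (hP : ‖P‖ ≤ 1) (φ : A →L[ℂ] (H →L[ℂ] H)) :
    ‖compress P φ‖ ≤ ‖φ‖ := by
  refine ContinuousLinearMap.opNorm_le_bound _ (norm_nonneg φ) fun a => ?_
  refine ContinuousLinearMap.opNorm_le_bound _ (by positivity) fun x => ?_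
  rw [compress_apply]
  have hP' : ∀ y, ‖P y‖ ≤ ‖y‖ := fun y => by simpa using P.le_of_opNorm_le hP y
  calc ‖P (φ a (P x))‖ ≤ ‖φ a (P x)‖ := hP' _
    _ ≤ ‖φ a‖ * ‖P x‖ := (φ a).le_opNorm _
    _ ≤ (‖φ‖ * ‖a‖) * ‖x‖ := by gcongr; exacts [φ.le_opNorm a, hP' x]

theorem tendsto_dualFunctional_compress (φ : A →L[ℂ] (H →L[ℂ] H))
    (x : ProjTensor A (TraceClass H)) :
    Tendsto (fun s => dualFunctional e (compress (basisProj e s) φ) x) atTop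
      (𝓝 (dualFunctional e φ x)) := by
  induction x using ProjTensor.induction_rankOne with
  | closed =>
    refine isClosed_setOf_tendsto_of_lipschitz (r := ‖φ‖) (.of_forall fun s x y => ?_) fun x y => ?_
    · rw [← map_sub]
      refine (norm_dualFunctional_le e _ _).trans ?_
      gcongr
      exact norm_compress_le (norm_basisProj_le e s) φ
    · rw [← map_sub]
      exact norm_dualFunctional_le e _ _
  | add x y hx hy => simpa only [map_add] using hx.add hy
  | mk a u v =>
    simp only [dualFunctional_mk_rankOne, compress_apply]
    have h1 : ∀ (s : Finset ι) (x y : H), ⟪x, basisProj e s y⟫_ℂ = ⟪basisProj e s x, y⟫_ℂ :=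
      fun s x y => by
        simp only [basisProj_apply, inner_sum, sum_inner, inner_smul_right, inner_smul_left,
          inner_conj_symm]
        exact Finset.sum_congr rfl fun i _ => mul_comm _ _
    simp only [h1]
    exact (tendsto_basisProj e _).inner
      (((φ a).continuous.tendsto _).comp (tendsto_basisProj e _))

/-- For `x = ∑ₗ aₗ ⊗ bₗ` of finite rank and finitely many basis vectors `wᵢ`, the matrix
`mᵢⱼ = ∑ₗ ⟪wᵢ, bₗ wⱼ⟫ aₗ` represents the compression of `x` to `K ⊗ span {wᵢ}`. -/
theorem exists_matrix_compress (φ : A →L[ℂ] (H →L[ℂ] H)) (s : Finset ι)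
    {x : ProjTensor A (TraceClass H)} (hx : x ∈ finiteRankTensors H A) :
    ∃ m : Matrix (Fin s.card) (Fin s.card) A,
      (∀ ξ : Fin s.card → K, ∑ i, ∑ j, ⟪ξ i, (m i j : K →L[ℂ] K) (ξ j)⟫_ℂ =
        ⟪∑ i, tensorRight (e (s.equivFin.symm i)) (ξ i), idTensor (.id ℂ (H →L[ℂ] H)) x
          (∑ i, tensorRight (e (s.equivFin.symm i)) (ξ i))⟫_ℂ) ∧
      dualFunctional e (compress (basisProj e s) φ) x =
        ∑ i, ∑ j, ⟪e (s.equivFin.symm i), φ (m i j) (e (s.equivFin.symm j))⟫_ℂ := by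
  refine finiteRankTensors_induction hx ?_ ?_
  · rintro x y ⟨m, h1, h2⟩ ⟨m', h1', h2'⟩
    refine ⟨m + m', fun ξ => ?_, ?_⟩
    · simp only [map_add, add_apply, inner_add_right, ← h1, ← h1', Matrix.add_apply,
        Submodule.coe_add, Finset.sum_add_distrib]
    · simp only [map_add, add_apply, inner_add_right, h2, h2', Matrix.add_apply,
        Finset.sum_add_distrib]
  · intro a u v
    set w : Fin s.card → H := fun i => e (s.equivFin.symm i)
    refine ⟨fun i j => (⟪w i, u⟫_ℂ * ⟪v, w j⟫_ℂ) • a, fun ξ => ?_, ?_⟩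
    · rw [inner_idTensor_mk_rankOne]
      simp only [map_sum, adjoint_tensorRight, sum_inner, inner_sum, inner_smul_left,
        inner_smul_right, map_smul, inner_conj_symm, Submodule.coe_smul, smul_apply, Finset.mul_sum]
      rw [Finset.sum_comm]
      refine Finset.sum_congr rfl fun i _ => Finset.sum_congr rfl fun j _ => ?_
      simp only [w]
      ring
    · have hP : ∀ y, basisProj e s y = ∑ i, ⟪w i, y⟫_ℂ • w i := fun y => by
        rw [basisProj_apply, ← Finset.sum_coe_sort]
        exact (Equiv.sum_comp s.equivFin.symm fun i : s => ⟪e i, y⟫_ℂ • e i).symm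
      have hw : ∀ i, conjL e (w i) = w i := fun i => conjL_basis e _
      rw [dualFunctional_mk_rankOne, compress_apply, hP, hP]
      simp only [map_sum, map_smul, smul_apply, inner_sum, inner_smul_right,
        Finset.sum_mul]
      refine Finset.sum_congr rfl fun i _ => Finset.sum_congr rfl fun j _ => ?_
      rw [inner_conjL, inner_conjL_right, hw, hw]
      ring

theorem norm_idTensor_le (α : (H →L[ℂ] H) →L[ℂ] (H →L[ℂ] H)) (x : ProjTensor A (TraceClass H)) :
    ‖idTensor α x‖ ≤ ‖α‖ * ‖x‖ := by
  refine (ProjTensor.norm_lift_le _ x).trans ?_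
  gcongr
  refine ContinuousLinearMap.opNorm_le_bound₂ _ (norm_nonneg α) fun a b => ?_
  refine (norm_opTensor_le (a : K →L[ℂ] K) (α b.op)).trans ?_
  calc ‖(a : K →L[ℂ] K)‖ * ‖α b.op‖ ≤ ‖a‖ * (‖α‖ * ‖b‖) := by
        gcongr
        · exact le_rfl
        · exact (α.le_opNorm _).trans (by gcongr; exact b.norm_op_le)
    _ = _ := by ring

theorem Accretive.re_inner_ge {V : Type*} [NormedAddCommGroup V] [InnerProductSpace ℂ V]
    {S T : V →L[ℂ] V} (hT : Accretive T) {δ : ℝ} (h : ‖S - T‖ ≤ δ) (ζ : V) :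
    -δ * ‖ζ‖ ^ 2 ≤ (⟪ζ, S ζ⟫_ℂ).re := by
  have h1 : ‖⟪ζ, (S - T) ζ⟫_ℂ‖ ≤ δ * ‖ζ‖ ^ 2 := by
    refine (norm_inner_le_norm _ _).trans ?_
    calc ‖ζ‖ * ‖(S - T) ζ‖ ≤ ‖ζ‖ * (δ * ‖ζ‖) := by
          gcongr; exact ContinuousLinearMap.le_of_opNorm_le _ h ζ
      _ = _ := by ring
  have h2 := (abs_le.mp ((Complex.abs_re_le_norm _).trans h1)).1
  rw [sub_apply, inner_sub_right, Complex.sub_re] at h2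
  linarith [hT ζ]

/-- The dual functional of a completely positive map has nonnegative real part on the elements
that are accretive on `K ⊗ H`. -/
theorem IsCompletelyPositive.re_dualFunctional_nonneg (hA : IsOperatorSystem A)
    {φ : A →L[ℂ] (H →L[ℂ] H)} (hφ : IsCompletelyPositive φ) (x : ProjTensor A (TraceClass H))
    (hx : Accretive (idTensor (.id ℂ (H →L[ℂ] H)) x)) :
    0 ≤ (dualFunctional e φ x).re := by
  refine ge_of_tendsto ((Complex.continuous_re.tendsto _).comp
    (tendsto_dualFunctional_compress e φ x)) (.of_forall fun s => ?_)
  rw [Function.comp_apply]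
  set w : Fin s.card → H := fun i => e (s.equivFin.symm i)
  set N := ‖ContinuousLinearMap.id ℂ (H →L[ℂ] H)‖
  set c : ℝ := N * (∑ i, ⟪w i, φ ⟨1, hA.one_mem⟩ (w i)⟫_ℂ).re
  -- For `y` of finite rank near `x`, the matrix of `y` is accretive up to `N ‖y - x‖`.
  have key : ∀ y ∈ finiteRankTensors H A,
      0 ≤ (dualFunctional e (compress (basisProj e s) φ) y).re + ‖y - x‖ * c := by
    intro y hy
    obtain ⟨m, hm, hd⟩ := exists_matrix_compress e φ s hy
    have h := hφ.re_sum_inner_ge hA m (N * ‖y - x‖) (fun ξ => ?_) w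
    · rw [← hd] at h
      simp only [c]
      linarith
    · rw [hm]
      set ζ := ∑ i, tensorRight (K := K) (e (s.equivFin.symm i)) (ξ i) with hζ
      have hnorm : ‖ζ‖ ^ 2 = ∑ i, ‖ξ i‖ ^ 2 := by
        have h1 : ⟪ζ, ζ⟫_ℂ = ∑ i, ((‖ξ i‖ ^ 2 : ℝ) : ℂ) := by
          rw [hζ]
          simp only [sum_inner, inner_sum, inner_tensorRight]
          refine Finset.sum_congr rfl fun i _ => ?_
          rw [Finset.sum_eq_single i]
          · rw [inner_self_eq_norm_sq_to_K, inner_self_eq_norm_sq_to_K, e.orthonormal.1]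
            simp
          · intro j _ hj
            rw [e.orthonormal.2, mul_zero]
            exact fun h => hj (s.equivFin.symm.injective (Subtype.ext h))
          · simp
        rw [inner_self_eq_norm_sq_to_K, ← Complex.ofReal_sum] at h1
        exact Complex.ofReal_injective ((Complex.ofReal_pow _ _).trans h1)
      rw [← hnorm]
      refine hx.re_inner_ge ?_ ζ
      rw [← map_sub]
      exact norm_idTensor_le _ _
  have hclosed : IsClosed {y | 0 ≤ (dualFunctional e (compress (basisProj e s) φ) y).re +
      ‖y - x‖ * c} := isClosed_le (by fun_prop) (by fun_prop)
  have h : 0 ≤ (dualFunctional e (compress (basisProj e s) φ) x).re + ‖x - x‖ * c :=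
    closure_minimal (fun y hy => key y hy) hclosed (dense_finiteRankTensors x)
  simpa using h

end Truncation

/-! ### Order structure on tensors of finite rank -/

section FiniteRank

variable {K H ι : Type*} [NormedAddCommGroup K] [InnerProductSpace ℂ K] [CompleteSpace K]
  [NormedAddCommGroup H] [InnerProductSpace ℂ H] [CompleteSpace H] (e : HilbertBasis ι ℂ H)
  {A : Submodule ℂ (K →L[ℂ] K)}

variable (H A) in
/-- The complex vector space of tensors of finite rank, as a type of its own: a copy of the subspace
`finiteRankTensors` with only its linear structure, which is all that order arguments use. -/
def FiniteRankTensor : Type _ := finiteRankTensors H A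

noncomputable instance : AddCommGroup (FiniteRankTensor H A) :=
  inferInstanceAs (AddCommGroup (finiteRankTensors H A))

noncomputable instance : Module ℂ (FiniteRankTensor H A) :=
  inferInstanceAs (Module ℂ (finiteRankTensors H A))

/-- The inclusion of the tensors of finite rank into `A ⊗̂ 𝒯(H)`. -/
noncomputable def FiniteRankTensor.toProj :
    FiniteRankTensor H A →ₗ[ℂ] ProjTensor A (TraceClass H) :=
  (finiteRankTensors H A).subtype

theorem FiniteRankTensor.toProj_injective :
    Function.Injective (toProj : FiniteRankTensor H A → ProjTensor A (TraceClass H)) :=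
  Subtype.val_injective

/-- The tensor `a ⊗ |u⟩⟨v|`, of finite rank. -/
noncomputable def rankOneTensor (a : A) (u v : H) : FiniteRankTensor H A :=
  ⟨ProjTensor.mk a (.rankOne u v), mk_rankOne_mem a u v⟩

theorem toProj_rankOneTensor (a : A) (u v : H) :
    (rankOneTensor a u v).toProj = ProjTensor.mkL A (TraceClass H) a (.rankOne u v) := rfl

theorem rankOneTensor_add (a b : A) (u v : H) :
    rankOneTensor (a + b) u v = rankOneTensor a u v + rankOneTensor b u v :=
  FiniteRankTensor.toProj_injective (by simp only [toProj_rankOneTensor, map_add, add_apply])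

theorem rankOneTensor_smul (c : ℂ) (a : A) (u v : H) :
    rankOneTensor (c • a) u v = c • rankOneTensor a u v :=
  FiniteRankTensor.toProj_injective (by simp only [toProj_rankOneTensor, map_smul, smul_apply])

theorem rankOneTensor_add_left (a : A) (u u' v : H) :
    rankOneTensor a (u + u') v = rankOneTensor a u v + rankOneTensor a u' v :=
  FiniteRankTensor.toProj_injective (by
    simp only [toProj_rankOneTensor, TraceClass.rankOne_add_left, map_add])

theorem rankOneTensor_add_right (a : A) (u v v' : H) :
    rankOneTensor a u (v + v') = rankOneTensor a u v + rankOneTensor a u v' :=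
  FiniteRankTensor.toProj_injective (by
    simp only [toProj_rankOneTensor, TraceClass.rankOne_add_right, map_add])

theorem rankOneTensor_smul_left (c : ℂ) (a : A) (u v : H) :
    rankOneTensor a (c • u) v = c • rankOneTensor a u v :=
  FiniteRankTensor.toProj_injective (by
    simp only [toProj_rankOneTensor, TraceClass.rankOne_smul_left, map_smul])

theorem rankOneTensor_smul_right (c : ℂ) (a : A) (u v : H) :
    rankOneTensor a u (c • v) = starRingEnd ℂ c • rankOneTensor a u v :=
  FiniteRankTensor.toProj_injective (by
    simp only [toProj_rankOneTensor, TraceClass.rankOne_smul_right, map_smul])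

@[elab_as_elim]
theorem rankOneTensor_induction {p : FiniteRankTensor H A → Prop} (x : FiniteRankTensor H A)
    (add : ∀ x y, p x → p y → p (x + y)) (mk : ∀ a u v, p (rankOneTensor a u v)) : p x := by
  obtain ⟨x, hx⟩ := x
  obtain ⟨hx', h⟩ : ∃ hx : x ∈ finiteRankTensors H A, p ⟨x, hx⟩ := by
    refine finiteRankTensors_induction hx ?_ fun a u v => ⟨mk_rankOne_mem a u v, mk a u v⟩
    rintro x y ⟨hx, hpx⟩ ⟨hy, hpy⟩
    exact ⟨add_mem hx hy, add _ _ hpx hpy⟩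
  exact h

variable (H A) in
/-- The operator on `K ⊗ H` given by a tensor of finite rank. -/
noncomputable def finiteRankOp :
    FiniteRankTensor H A →ₗ[ℂ] (HilbertTensor K H →L[ℂ] HilbertTensor K H) :=
  (idTensor (A := A) (.id ℂ (H →L[ℂ] H))).toLinearMap ∘ₗ FiniteRankTensor.toProj

theorem finiteRankOp_apply (x : FiniteRankTensor H A) :
    finiteRankOp H A x = idTensor (.id ℂ (H →L[ℂ] H)) x.toProj := rfl

theorem inner_finiteRankOp_rankOneTensor (a : A) (u v : H) (ζ : HilbertTensor K H) :
    ⟪ζ, finiteRankOp H A (rankOneTensor a u v) ζ⟫_ℂ =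
      ⟪ContinuousLinearMap.adjoint (tensorRight u) ζ,
        (a : K →L[ℂ] K) (ContinuousLinearMap.adjoint (tensorRight v) ζ)⟫_ℂ :=
  inner_idTensor_mk_rankOne a u v ζ

/-- The partial transpose `ι ⊗ t` on the tensors of finite rank. -/
noncomputable def finiteRankTranspose : FiniteRankTensor H A →ₗ[ℂ] FiniteRankTensor H A where
  toFun x := ⟨partialTranspose e x.toProj, partialTranspose_mem e x.2⟩
  map_add' x y := FiniteRankTensor.toProj_injective (map_add (partialTranspose e) x.toProj y.toProj)
  map_smul' c x := FiniteRankTensor.toProj_injective (map_smul (partialTranspose e) c x.toProj)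

theorem toProj_finiteRankTranspose (x : FiniteRankTensor H A) :
    (finiteRankTranspose e x).toProj = partialTranspose e x.toProj := rfl

theorem finiteRankTranspose_rankOneTensor (a : A) (u v : H) :
    finiteRankTranspose e (rankOneTensor a u v) =
      rankOneTensor a (conjL e v) (conjL e u) := by
  refine FiniteRankTensor.toProj_injective ?_
  rw [toProj_finiteRankTranspose, toProj_rankOneTensor, toProj_rankOneTensor,
    ProjTensor.mkL_apply, partialTranspose_mk, transposeTraceClass_rankOne]
  rfl

theorem finiteRankTranspose_finiteRankTranspose (x : FiniteRankTensor H A) :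
    finiteRankTranspose e (finiteRankTranspose e x) = x :=
  FiniteRankTensor.toProj_injective (partialTranspose_partialTranspose e x.toProj)

theorem dualFunctional_rankOneTensor (φ : A →L[ℂ] (H →L[ℂ] H)) (a : A) (u v : H) :
    dualFunctional e φ (rankOneTensor a u v).toProj = ⟪conjL e u, φ a (conjL e v)⟫_ℂ :=
  dualFunctional_mk_rankOne e φ a u v

/-- The tensor `‖a‖ / 2 ⊗ (|u⟩⟨u| + |v⟩⟨v|)`, which dominates `a ⊗ |u⟩⟨v|`. -/
noncomputable def dominatingTensor (hA : IsOperatorSystem A) (a : A) (u v : H) :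
    FiniteRankTensor H A :=
  ((‖a‖ / 2 : ℝ) : ℂ) •
    (rankOneTensor ⟨1, hA.one_mem⟩ u u + rankOneTensor ⟨1, hA.one_mem⟩ v v)

theorem inner_finiteRankOp_one (hA : IsOperatorSystem A) (u : H) (ζ : HilbertTensor K H) :
    ⟪ζ, finiteRankOp H A (rankOneTensor ⟨1, hA.one_mem⟩ u u) ζ⟫_ℂ =
      ((‖ContinuousLinearMap.adjoint (tensorRight (K := K) u) ζ‖ ^ 2 : ℝ) : ℂ) := by
  rw [inner_finiteRankOp_rankOneTensor, one_apply_eq_self, inner_self_eq_norm_sq_to_K]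
  exact (Complex.ofReal_pow _ _).symm

theorem accretive_one (hA : IsOperatorSystem A) (u : H) :
    Accretive (finiteRankOp H A (rankOneTensor ⟨1, hA.one_mem⟩ u u)) := fun ζ => by
  rw [inner_finiteRankOp_one hA, Complex.ofReal_re]
  positivity

theorem re_inner_dominatingTensor (hA : IsOperatorSystem A) (a : A) (u v : H)
    (ζ : HilbertTensor K H) :
    (⟪ζ, finiteRankOp H A (dominatingTensor hA a u v) ζ⟫_ℂ).re =
      ‖a‖ / 2 * (‖ContinuousLinearMap.adjoint (tensorRight (K := K) u) ζ‖ ^ 2 +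
        ‖ContinuousLinearMap.adjoint (tensorRight (K := K) v) ζ‖ ^ 2) := by
  rw [dominatingTensor, map_smul, map_add, smul_apply, add_apply, inner_smul_right,
    inner_add_right, inner_finiteRankOp_one hA, inner_finiteRankOp_one hA, ← Complex.ofReal_add,
    ← Complex.ofReal_mul, Complex.ofReal_re]

theorem accretive_dominatingTensor (hA : IsOperatorSystem A) (a : A) (u v : H) :
    Accretive (finiteRankOp H A (dominatingTensor hA a u v)) := fun ζ => by
  rw [re_inner_dominatingTensor]
  positivity

theorem accretive_dominatingTensor_add (hA : IsOperatorSystem A) (a : A) (u v : H) :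
    Accretive (finiteRankOp H A (dominatingTensor hA a u v + rankOneTensor a u v)) := fun ζ => by
  rw [map_add, add_apply, inner_add_right, Complex.add_re, re_inner_dominatingTensor,
    inner_finiteRankOp_rankOneTensor]
  set x := ContinuousLinearMap.adjoint (tensorRight (K := K) u) ζ
  set y := ContinuousLinearMap.adjoint (tensorRight (K := K) v) ζ
  have h1 : ‖⟪x, (a : K →L[ℂ] K) y⟫_ℂ‖ ≤ ‖x‖ * (‖a‖ * ‖y‖) :=
    (norm_inner_le_norm _ _).trans (by gcongr; exact (a : K →L[ℂ] K).le_opNorm y)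
  have h2 := (abs_le.mp ((Complex.abs_re_le_norm _).trans h1)).1
  nlinarith [mul_nonneg (norm_nonneg a) (sq_nonneg (‖x‖ - ‖y‖))]

theorem dominatingTensor_transpose (hA : IsOperatorSystem A) (a : A) (u v : H) :
    finiteRankTranspose e (dominatingTensor hA a u v) =
      dominatingTensor hA a (conjL e v) (conjL e u) := by
  rw [dominatingTensor, map_smul, map_add, finiteRankTranspose_rankOneTensor,
    finiteRankTranspose_rankOneTensor, add_comm, dominatingTensor]

/-- Every tensor of finite rank is dominated by one of finite rank which is positive and has
positive partial transpose, simultaneously for both orders. -/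
theorem exists_dominating (hA : IsOperatorSystem A) (x : FiniteRankTensor H A) :
    ∃ z : FiniteRankTensor H A, Accretive (finiteRankOp H A z) ∧
      Accretive (finiteRankOp H A (z + x)) ∧
      Accretive (finiteRankOp H A (finiteRankTranspose e z)) ∧
      Accretive (finiteRankOp H A (finiteRankTranspose e (z + x))) := by
  induction x using rankOneTensor_induction with
  | add x y hx hy =>
    obtain ⟨z, h1, h2, h3, h4⟩ := hx
    obtain ⟨w, k1, k2, k3, k4⟩ := hy
    refine ⟨z + w, ?_, ?_, ?_, ?_⟩
    · rw [map_add]; exact h1.add k1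
    · rw [add_add_add_comm, map_add]; exact h2.add k2
    · rw [map_add, map_add]; exact h3.add k3
    · rw [add_add_add_comm, map_add, map_add]; exact h4.add k4
  | mk a u v =>
    refine ⟨dominatingTensor hA a u v, accretive_dominatingTensor hA a u v,
      accretive_dominatingTensor_add hA a u v, ?_, ?_⟩
    · rw [dominatingTensor_transpose]
      exact accretive_dominatingTensor hA a _ _
    · rw [map_add, dominatingTensor_transpose, finiteRankTranspose_rankOneTensor]
      exact accretive_dominatingTensor_add hA a _ _

/-- An adjoint of a tensor of finite rank. Its existence, with the stated properties, is proved for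
elementary tensors and extended by additivity, so that no involution on `A ⊗̂ 𝒯(H)` is needed. -/
theorem exists_adjoint (hA : IsOperatorSystem A) {φ : A →L[ℂ] (H →L[ℂ] H)}
    (hφ : IsPositiveMap φ) (x : FiniteRankTensor H A) :
    ∃ y : FiniteRankTensor H A,
      (∀ ζ, ⟪ζ, finiteRankOp H A y ζ⟫_ℂ = starRingEnd ℂ ⟪ζ, finiteRankOp H A x ζ⟫_ℂ) ∧
      (∀ ζ, ⟪ζ, finiteRankOp H A (finiteRankTranspose e y) ζ⟫_ℂ =
        starRingEnd ℂ ⟪ζ, finiteRankOp H A (finiteRankTranspose e x) ζ⟫_ℂ) ∧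
      dualFunctional e φ y.toProj = starRingEnd ℂ (dualFunctional e φ x.toProj) := by
  induction x using rankOneTensor_induction with
  | add x x' hx hx' =>
    obtain ⟨y, h1, h2, h3⟩ := hx
    obtain ⟨y', k1, k2, k3⟩ := hx'
    refine ⟨y + y', fun ζ => ?_, fun ζ => ?_, ?_⟩
    · simp only [map_add, add_apply, inner_add_right, h1, k1]
    · simp only [map_add, add_apply, inner_add_right, h2, k2]
    · simp only [map_add, h3, k3]
  | mk a u v =>
    have h : ∀ (u v : H) (ζ : HilbertTensor K H),
        ⟪ζ, finiteRankOp H A (rankOneTensor ⟨star (a : K →L[ℂ] K), hA.star_mem a a.2⟩ v u) ζ⟫_ℂ =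
          starRingEnd ℂ ⟪ζ, finiteRankOp H A (rankOneTensor a u v) ζ⟫_ℂ := fun u v ζ => by
      rw [inner_finiteRankOp_rankOneTensor, inner_finiteRankOp_rankOneTensor, inner_conj_symm]
      exact ContinuousLinearMap.adjoint_inner_right _ _ _
    refine ⟨rankOneTensor ⟨star (a : K →L[ℂ] K), hA.star_mem a a.2⟩ v u, h u v, fun ζ => ?_, ?_⟩
    · rw [finiteRankTranspose_rankOneTensor, finiteRankTranspose_rankOneTensor, h]
    · rw [dualFunctional_rankOneTensor, dualFunctional_rankOneTensor,
        hφ.map_star hA, inner_conj_symm, ContinuousLinearMap.star_eq_adjoint,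
        ContinuousLinearMap.adjoint_inner_right]

end FiniteRank

/-! ### Completely positive maps from positive functionals -/

section FromFunctional

variable {K H ι : Type*} [NormedAddCommGroup K] [InnerProductSpace ℂ K] [CompleteSpace K]
  [NormedAddCommGroup H] [InnerProductSpace ℂ H] [CompleteSpace H] (e : HilbertBasis ι ℂ H)
  {A : Submodule ℂ (K →L[ℂ] K)}

/-- By homogeneity, a bound by `‖u‖² + ‖v‖²` improves to one by `2 ‖u‖ ‖v‖`. -/
theorem norm_le_of_forall_sq (f : H → H → ℂ)
    (hl : ∀ (c : ℂ) u v, ‖f (c • u) v‖ = ‖c‖ * ‖f u v‖)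
    (hr : ∀ (c : ℂ) u v, ‖f u (c • v)‖ = ‖c‖ * ‖f u v‖) {M : ℝ}
    (h : ∀ u v, ‖f u v‖ ≤ M * (‖u‖ ^ 2 + ‖v‖ ^ 2)) (u v : H) :
    ‖f u v‖ ≤ 2 * M * ‖u‖ * ‖v‖ := by
  by_cases hu : u = 0
  · have := hl 0 u v
    rw [zero_smul, norm_zero, zero_mul] at this
    rw [hu, this, norm_zero, mul_zero, zero_mul]
  by_cases hv : v = 0
  · have := hr 0 u v
    rw [zero_smul, norm_zero, zero_mul] at this
    rw [hv, this, norm_zero, mul_zero]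
  have hu' := norm_pos_iff.mpr hu
  have hv' := norm_pos_iff.mpr hv
  have h1 := h (((‖u‖⁻¹ : ℝ) : ℂ) • u) (((‖v‖⁻¹ : ℝ) : ℂ) • v)
  rw [hl, hr, norm_smul, norm_smul, Complex.norm_real, Complex.norm_real, norm_inv, norm_inv,
    norm_norm, norm_norm, inv_mul_cancel₀ hu'.ne', inv_mul_cancel₀ hv'.ne'] at h1
  calc ‖f u v‖ = (‖u‖⁻¹ * (‖v‖⁻¹ * ‖f u v‖)) * (‖u‖ * ‖v‖) := by field_simp
    _ ≤ (M * (1 ^ 2 + 1 ^ 2)) * (‖u‖ * ‖v‖) := by gcongr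
    _ = _ := by ring

/-- A functional on the tensors of finite rank which is bounded on the elementary tensors is the
dual functional of a map into `B(H)`. -/
theorem exists_map_of_bound (s : FiniteRankTensor H A →ₗ[ℂ] ℂ) {M : ℝ} (hM : 0 ≤ M)
    (hs : ∀ a u v, ‖s (rankOneTensor a u v)‖ ≤ M * ‖a‖ * ‖u‖ * ‖v‖) :
    ∃ φ : A →L[ℂ] (H →L[ℂ] H), ∀ a u v,
      ⟪u, φ a v⟫_ℂ = s (rankOneTensor a (conjL e u) (conjL e v)) := by
  let B : A → H →L⋆[ℂ] H →L[ℂ] ℂ := fun a => LinearMap.mkContinuous₂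
    (LinearMap.mk₂'ₛₗ (starRingEnd ℂ) (RingHom.id ℂ)
      (fun u v => s (rankOneTensor a (conjL e u) (conjL e v)))
      (fun u u' v => by rw [map_add, rankOneTensor_add_left, map_add])
      (fun c u v => by
        rw [ContinuousLinearMap.map_smulₛₗ, rankOneTensor_smul_left, map_smul])
      (fun u v v' => by rw [map_add, rankOneTensor_add_right, map_add])
      (fun c u v => by
        rw [ContinuousLinearMap.map_smulₛₗ, rankOneTensor_smul_right, map_smul,
          RingHom.id_apply, Complex.conj_conj])) (M * ‖a‖)
    fun u v => by
      have h := hs a (conjL e u) (conjL e v)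
      rwa [norm_conjL, norm_conjL] at h
  let T : A → H →L[ℂ] H := fun a =>
    ContinuousLinearMap.adjoint (InnerProductSpace.continuousLinearMapOfBilin (B a))
  have hT : ∀ a u v, ⟪u, T a v⟫_ℂ = s (rankOneTensor a (conjL e u) (conjL e v)) := fun a u v => by
    rw [ContinuousLinearMap.adjoint_inner_right,
      InnerProductSpace.continuousLinearMapOfBilin_apply]
    rfl
  refine ⟨LinearMap.mkContinuous
    { toFun := T
      map_add' := fun a b => ?_
      map_smul' := fun c a => ?_ } M fun a => ?_, hT⟩
  · ext v
    refine ext_inner_left ℂ fun u => ?_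
    rw [add_apply, inner_add_right, hT, hT, hT, rankOneTensor_add, map_add]
  · ext v
    refine ext_inner_left ℂ fun u => ?_
    rw [smul_apply, inner_smul_right, hT, hT, rankOneTensor_smul, map_smul, RingHom.id_apply,
      smul_eq_mul]
  · refine ContinuousLinearMap.opNorm_le_of_re_inner_le (by positivity) fun v u hv hu => ?_
    have h := hs a (conjL e u) (conjL e v)
    rw [norm_conjL, norm_conjL, hu, hv, mul_one, mul_one, ← hT, norm_inner_symm] at h
    exact (Complex.re_le_norm _).trans h

/-- A real functional on the tensors of finite rank which is nonnegative on the accretive ones is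
the real part of the dual functional of a completely positive map. -/
theorem exists_completelyPositive (hA : IsOperatorSystem A) (g : FiniteRankTensor H A →ₗ[ℝ] ℝ)
    (hg : ∀ x, Accretive (finiteRankOp H A x) → 0 ≤ g x) {C : ℝ}
    (hC : ∀ u, g (rankOneTensor ⟨1, hA.one_mem⟩ u u) ≤ C * ‖u‖ ^ 2) (hC0 : 0 ≤ C) :
    ∃ φ : A →L[ℂ] (H →L[ℂ] H), IsCompletelyPositive φ ∧
      ∀ x : FiniteRankTensor H A, (dualFunctional e φ x.toProj).re = g x := by
  let s : FiniteRankTensor H A →ₗ[ℂ] ℂ := Module.Dual.extendRCLike (𝕜 := ℂ) g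
  have hs : ∀ x, s x = (g x : ℂ) - Complex.I * (g (Complex.I • x) : ℂ) := fun x => rfl
  have hre : ∀ x, (s x).re = g x := fun x => by simp [hs]
  have hgu : ∀ (a : A) (u v : H), -g (rankOneTensor a u v) ≤
      ‖a‖ / 2 * (C * (‖u‖ ^ 2 + ‖v‖ ^ 2)) := fun a u v => by
    have h := hg _ (accretive_dominatingTensor_add hA a u v)
    have h1 : g (dominatingTensor hA a u v) = ‖a‖ / 2 *
        (g (rankOneTensor ⟨1, hA.one_mem⟩ u u) + g (rankOneTensor ⟨1, hA.one_mem⟩ v v)) := by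
      rw [dominatingTensor, Complex.coe_smul, map_smul, map_add, smul_eq_mul]
    rw [map_add, h1] at h
    have h2 : ‖a‖ / 2 * (g (rankOneTensor ⟨1, hA.one_mem⟩ u u) +
        g (rankOneTensor ⟨1, hA.one_mem⟩ v v)) ≤ ‖a‖ / 2 * (C * (‖u‖ ^ 2 + ‖v‖ ^ 2)) := by
      have := hC u
      have := hC v
      gcongr
      linarith
    linarith
  have hgabs : ∀ (a : A) (u v : H), |g (rankOneTensor a u v)| ≤
      ‖a‖ / 2 * (C * (‖u‖ ^ 2 + ‖v‖ ^ 2)) := fun a u v => by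
    refine abs_le.mpr ⟨by linarith [hgu a u v], ?_⟩
    have h := hgu (-a) u v
    have h1 : rankOneTensor (-a) u v = -rankOneTensor a u v := by
      rw [← neg_one_smul ℂ, rankOneTensor_smul, neg_one_smul]
    rwa [norm_neg, h1, map_neg, neg_neg] at h
  have hsbound : ∀ (a : A) (u v : H),
      ‖s (rankOneTensor a u v)‖ ≤ ‖a‖ * C * (‖u‖ ^ 2 + ‖v‖ ^ 2) := fun a u v => by
    rw [hs, ← rankOneTensor_smul]
    refine (norm_sub_le _ _).trans ?_
    rw [norm_mul, Complex.norm_I, one_mul, Complex.norm_real, Complex.norm_real,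
      Real.norm_eq_abs, Real.norm_eq_abs]
    have h1 := hgabs a u v
    have h2 := hgabs (Complex.I • a) u v
    rw [norm_smul, Complex.norm_I, one_mul] at h2
    linarith
  obtain ⟨φ, hφ⟩ := exists_map_of_bound e s (M := 2 * C) (by positivity) fun a u v => by
    refine (norm_le_of_forall_sq (fun u v => s (rankOneTensor a u v)) (fun c u v => ?_)
      (fun c u v => ?_) (hsbound a) u v).trans (le_of_eq (by ring))
    · rw [rankOneTensor_smul_left, map_smul, norm_smul]
    · rw [rankOneTensor_smul_right, map_smul, norm_smul, RCLike.norm_conj]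
  refine ⟨φ, fun n m hm η => ?_, fun x => ?_⟩
  · have h : ∑ i, ∑ j, ⟪η i, (m.map φ) i j (η j)⟫_ℂ =
        s (∑ i, ∑ j, rankOneTensor (m i j) (conjL e (η i)) (conjL e (η j))) := by
      simp only [map_sum, Matrix.map_apply, hφ]
    rw [h]
    refine nonneg_of_re_nonneg (finiteRankOp H A) s (fun x hx => (hre x).symm ▸ hg x hx) _ ?_
    refine nonneg_iff_forall_inner.mpr fun ζ => ?_
    simp only [map_sum, sum_apply, inner_sum,
      inner_finiteRankOp_rankOneTensor]
    exact hm fun i => ContinuousLinearMap.adjoint (tensorRight (conjL e (η i))) ζ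
  · rw [← hre]
    congr 1
    induction x using rankOneTensor_induction with
    | add x y hx hy => rw [map_add, map_add, map_add, hx, hy]
    | mk a u v =>
      rw [dualFunctional_rankOneTensor, hφ, conjL_conjL, conjL_conjL]

end FromFunctional

/-! ### Decomposable maps -/

section Decomposable

variable {K H ι : Type*} [NormedAddCommGroup K] [InnerProductSpace ℂ K] [CompleteSpace K]
  [NormedAddCommGroup H] [InnerProductSpace ℂ H] [CompleteSpace H] (e : HilbertBasis ι ℂ H)
  {A : Submodule ℂ (K →L[ℂ] K)}

theorem accretive_finiteRankOp_smul {x : FiniteRankTensor H A}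
    (hx : Accretive (finiteRankOp H A x)) {c : ℝ} (hc : 0 ≤ c) :
    Accretive (finiteRankOp H A (c • x)) := fun ζ => by
  rw [← Complex.coe_smul, map_smul, smul_apply, inner_smul_right, Complex.re_ofReal_mul]
  exact mul_nonneg hc (hx ζ)

/-- The pairs `(x, y)` of tensors of finite rank with `x` and `(ι ⊗ t)(y)` accretive. -/
noncomputable def accretivePairs : PointedCone ℝ (FiniteRankTensor H A × FiniteRankTensor H A) where
  carrier := {p | Accretive (finiteRankOp H A p.1) ∧
    Accretive (finiteRankOp H A (finiteRankTranspose e p.2))}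
  add_mem' := by
    rintro p q ⟨h1, h2⟩ ⟨k1, k2⟩
    refine ⟨?_, ?_⟩
    · rw [Prod.fst_add, map_add]; exact h1.add k1
    · rw [Prod.snd_add, map_add, map_add]; exact h2.add k2
  zero_mem' := by
    refine ⟨fun ζ => ?_, fun ζ => ?_⟩ <;> simp
  smul_mem' := by
    rintro ⟨c, hc⟩ p ⟨h1, h2⟩
    refine ⟨accretive_finiteRankOp_smul h1 hc, ?_⟩
    have h : finiteRankTranspose e (c • p.2) = c • finiteRankTranspose e p.2 := by
      rw [← Complex.coe_smul, map_smul, Complex.coe_smul]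
    change Accretive (finiteRankOp H A (finiteRankTranspose e (c • p.2)))
    rw [h]
    exact accretive_finiteRankOp_smul h2 hc

/-- A functional which is nonnegative on the intersection of the cone of accretive tensors and the
cone of tensors with accretive partial transpose is the sum of one functional nonnegative on the
first cone and one nonnegative on the second. -/
theorem exists_add_of_nonneg_inter (hA : IsOperatorSystem A) (f : FiniteRankTensor H A →ₗ[ℝ] ℝ)
    (hf : ∀ x, Accretive (finiteRankOp H A x) →
      Accretive (finiteRankOp H A (finiteRankTranspose e x)) → 0 ≤ f x) :
    ∃ g₁ g₂ : FiniteRankTensor H A →ₗ[ℝ] ℝ, (∀ x, f x = g₁ x + g₂ x) ∧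
      (∀ x, Accretive (finiteRankOp H A x) → 0 ≤ g₁ x) ∧
      ∀ x, Accretive (finiteRankOp H A (finiteRankTranspose e x)) → 0 ≤ g₂ x := by
  let W := FiniteRankTensor H A
  -- `F` is `f` as a functional on the diagonal of `W × W`.
  let F : (W × W) →ₗ.[ℝ] ℝ :=
    { domain := LinearMap.eqLocus (LinearMap.fst ℝ W W) (LinearMap.snd ℝ W W)
      toFun := (f ∘ₗ LinearMap.fst ℝ W W) ∘ₗ Submodule.subtype _ }
  have hF : ∀ x : F.domain, F x = f (x : W × W).1 := fun x => rfl
  have hdiag : ∀ x : W, (x, x) ∈ F.domain := fun x => rfl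
  have hFpos : ∀ x : F.domain, (x : W × W) ∈ accretivePairs e → 0 ≤ F x := fun x hx => by
    have h : (x : W × W).1 = (x : W × W).2 := x.2
    rw [hF]
    exact hf _ hx.1 (h ▸ hx.2)
  have hFdom : ∀ y : W × W, ∃ x : F.domain, (x : W × W) + y ∈ accretivePairs e := fun y => by
    obtain ⟨z, h1, h2, h3, h4⟩ := exists_dominating e hA y.1
    obtain ⟨w, k1, k2, k3, k4⟩ := exists_dominating e hA y.2
    refine ⟨⟨(z + w, z + w), hdiag _⟩, ?_, ?_⟩
    · change Accretive (finiteRankOp H A (z + w + y.1))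
      rw [add_right_comm, map_add]
      exact h2.add k1
    · change Accretive (finiteRankOp H A (finiteRankTranspose e (z + w + y.2)))
      rw [add_assoc, map_add, map_add]
      exact h3.add k4
  obtain ⟨g, hgF, hg⟩ := riesz_extension (accretivePairs e) F hFpos hFdom
  refine ⟨g ∘ₗ LinearMap.inl ℝ W W, g ∘ₗ LinearMap.inr ℝ W W, fun x => ?_, fun x hx => ?_,
    fun x hx => ?_⟩
  · have h := hgF ⟨(x, x), hdiag x⟩
    rw [hF] at h
    change f x = g (x, 0) + g (0, x)
    rw [← map_add, Prod.mk_add_mk, add_zero, zero_add]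
    exact h.symm
  · exact hg (x, 0) ⟨hx, fun ζ => by simp⟩
  · exact hg (0, x) ⟨fun ζ => by simp, hx⟩

/-- A map is determined by the real part of its dual functional on the tensors of finite rank. -/
theorem map_ext_of_re_dualFunctional {φ ψ : A →L[ℂ] (H →L[ℂ] H)}
    (h : ∀ x : FiniteRankTensor H A,
      (dualFunctional e φ x.toProj).re = (dualFunctional e ψ x.toProj).re) : φ = ψ := by
  have h1 : ∀ x : FiniteRankTensor H A, dualFunctional e φ x.toProj = dualFunctional e ψ x.toProj :=
    fun x => by
      refine Complex.ext (h x) ?_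
      have h2 := h (Complex.I • x)
      simp only [map_smul, smul_eq_mul, Complex.I_mul_re] at h2
      exact neg_injective h2
  ext a v
  refine ext_inner_left ℂ fun u => ?_
  have h2 := h1 (rankOneTensor a (conjL e u) (conjL e v))
  rwa [dualFunctional_rankOneTensor, dualFunctional_rankOneTensor, conjL_conjL, conjL_conjL] at h2

theorem IsCompletelyPositive.dualFunctional_nonneg (hA : IsOperatorSystem A)
    {φ : A →L[ℂ] (H →L[ℂ] H)} (hφ : IsCompletelyPositive φ) (x : ProjTensor A (TraceClass H))
    (hx : 0 ≤ idTensor (.id ℂ (H →L[ℂ] H)) x) : 0 ≤ dualFunctional e φ x :=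
  nonneg_of_re_nonneg (idTensor (A := A) (.id ℂ (H →L[ℂ] H))).toLinearMap
    (dualFunctional e φ).toLinearMap (fun y hy => hφ.re_dualFunctional_nonneg e hA y hy) x hx

theorem IsDecomposable.dualFunctional_nonneg (hA : IsOperatorSystem A)
    {φ : A →L[ℂ] (H →L[ℂ] H)} (hφ : IsDecomposable e φ) (x : ProjTensor A (TraceClass H))
    (hx : 0 ≤ idTensor (.id ℂ (H →L[ℂ] H)) x) (hxt : 0 ≤ idTensor (transpose e) x) :
    0 ≤ dualFunctional e φ x := by
  obtain ⟨φ₁, φ₂, h1, h2, rfl⟩ := hφ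
  rw [dualFunctional_add]
  refine add_nonneg (h1.dualFunctional_nonneg e hA x hx) ?_
  rw [← partialTranspose_partialTranspose e x, dualFunctional_partialTranspose]
  refine IsCompletelyPositive.dualFunctional_nonneg e hA h2 _ ?_
  rwa [idTensor_partialTranspose]

theorem isDecomposable_of_dualFunctional_nonneg (hA : IsOperatorSystem A)
    {φ : A →L[ℂ] (H →L[ℂ] H)} (hφ : IsPositiveMap φ)
    (h : ∀ x : ProjTensor A (TraceClass H), 0 ≤ idTensor (.id ℂ (H →L[ℂ] H)) x →
      0 ≤ idTensor (transpose e) x → 0 ≤ dualFunctional e φ x) : IsDecomposable e φ := by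
  let f : FiniteRankTensor H A →ₗ[ℝ] ℝ := Complex.reLm ∘ₗ
    ((dualFunctional e φ).toLinearMap ∘ₗ FiniteRankTensor.toProj).restrictScalars ℝ
  have hf : ∀ x, f x = (dualFunctional e φ x.toProj).re := fun x => rfl
  obtain ⟨g₁, g₂, hfg, hg₁, hg₂⟩ := exists_add_of_nonneg_inter e hA f fun x hx hxt => by
    -- Twice the hermitian part of `x` is positive and has positive partial transpose.
    obtain ⟨y, h1, h2, h3⟩ := exists_adjoint e hA hφ x
    have h4 : 0 ≤ dualFunctional e φ (x + y).toProj := by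
      refine h _ ?_ ?_
      · rw [← finiteRankOp_apply]
        refine nonneg_iff_forall_inner.mpr fun ζ => ?_
        rw [map_add, add_apply, inner_add_right, h1, Complex.add_conj]
        exact Complex.zero_le_real.mpr (mul_nonneg zero_le_two (hx ζ))
      · rw [← idTensor_partialTranspose, ← toProj_finiteRankTranspose, ← finiteRankOp_apply]
        refine nonneg_iff_forall_inner.mpr fun ζ => ?_
        rw [map_add, map_add, add_apply, inner_add_right, h2, Complex.add_conj]
        exact Complex.zero_le_real.mpr (mul_nonneg zero_le_two (hxt ζ))
    rw [map_add, map_add, h3, Complex.add_conj] at h4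
    have h5 := Complex.zero_le_real.mp h4
    rw [hf]
    linarith
  have hone : ∀ u : H, f (rankOneTensor ⟨1, hA.one_mem⟩ u u) ≤
      ‖φ ⟨1, hA.one_mem⟩‖ * ‖u‖ ^ 2 := fun u => by
    rw [hf, dualFunctional_rankOneTensor]
    refine (Complex.re_le_norm _).trans ((norm_inner_le_norm _ _).trans ?_)
    have h1 := (φ ⟨1, hA.one_mem⟩).le_opNorm (conjL e u)
    rw [norm_conjL] at h1 ⊢
    calc ‖u‖ * ‖φ ⟨1, hA.one_mem⟩ (conjL e u)‖ ≤ ‖u‖ * (‖φ ⟨1, hA.one_mem⟩‖ * ‖u‖) := by gcongr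
      _ = _ := by ring
  have honet : ∀ u : H, finiteRankTranspose e (rankOneTensor (A := A) ⟨1, hA.one_mem⟩ u u) =
      rankOneTensor ⟨1, hA.one_mem⟩ (conjL e u) (conjL e u) := fun u =>
    finiteRankTranspose_rankOneTensor e _ _ _
  obtain ⟨φ₁, hφ₁, hd₁⟩ := exists_completelyPositive e hA g₁ hg₁ (fun u => by
    have h1 := hone u
    have h2 := hg₂ (rankOneTensor ⟨1, hA.one_mem⟩ u u) (by rw [honet]; exact accretive_one hA _)
    rw [hfg] at h1
    linarith) (norm_nonneg (φ ⟨1, hA.one_mem⟩))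
  obtain ⟨ψ, hψ, hd₂⟩ := exists_completelyPositive e hA
    (g₂ ∘ₗ (finiteRankTranspose e).restrictScalars ℝ)
    (fun x hx => hg₂ _ (by
      change Accretive (finiteRankOp H A (finiteRankTranspose e (finiteRankTranspose e x)))
      rwa [finiteRankTranspose_finiteRankTranspose])) (fun u => by
    have h1 := hone (conjL e u)
    have h2 := hg₁ (rankOneTensor ⟨1, hA.one_mem⟩ (conjL e u) (conjL e u)) (accretive_one hA _)
    rw [hfg, norm_conjL] at h1
    change g₂ (finiteRankTranspose e (rankOneTensor ⟨1, hA.one_mem⟩ u u)) ≤ _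
    rw [honet]
    linarith) (norm_nonneg (φ ⟨1, hA.one_mem⟩))
  refine ⟨φ₁, (transpose e).comp ψ, hφ₁, ?_, map_ext_of_re_dualFunctional e fun x => ?_⟩
  · have h1 : (transpose e).comp ((transpose e).comp ψ) = ψ := by
      ext1 a
      exact transpose_transpose e (ψ a)
    rwa [IsCompletelyCopositive, h1]
  · have h1 := hd₂ (finiteRankTranspose e x)
    rw [toProj_finiteRankTranspose, dualFunctional_partialTranspose] at h1
    rw [dualFunctional_add, Complex.add_re, hd₁, h1, ← hf, hfg]
    change _ = g₁ x + g₂ (finiteRankTranspose e (finiteRankTranspose e x))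
    rw [finiteRankTranspose_finiteRankTranspose]

end Decomposable

/-! ### Positivity of tensor products of operators -/

section OpTensor

variable {K H : Type*} [NormedAddCommGroup K] [InnerProductSpace ℂ K]
  [NormedAddCommGroup H] [InnerProductSpace ℂ H]

@[elab_as_elim]
theorem hilbertTensor_induction {p : HilbertTensor K H → Prop} (z : HilbertTensor K H)
    (closed : IsClosed {z | p z}) (add : ∀ z w, p z → p w → p (z + w))
    (tmul : ∀ u k, p (tensorRight u k)) : p z := by
  induction z using Completion.induction_on with
  | hp => exact closed
  | ih z =>
    induction z using TensorProduct.induction_on with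
    | zero =>
      have h := tmul 0 0
      rwa [map_zero] at h
    | tmul k u => exact tmul u k
    | add z w hz hw => rw [Completion.coe_add]; exact add _ _ hz hw

theorem opTensor_mul (a c : K →L[ℂ] K) (b d : H →L[ℂ] H) :
    opTensor (a * c) (b * d) = opTensor a b * opTensor c d :=
  hilbertTensor_clm_ext fun u k => by
    simp only [mul_apply_eq_comp, opTensor_tensorRight]

variable [CompleteSpace K] [CompleteSpace H]

theorem star_opTensor (a : K →L[ℂ] K) (b : H →L[ℂ] H) :
    star (opTensor a b) = opTensor (star a) (star b) := by
  refine hilbertTensor_clm_ext fun u k => ext_inner_left ℂ fun z => ?_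
  rw [ContinuousLinearMap.star_eq_adjoint, ContinuousLinearMap.adjoint_inner_right]
  induction z using hilbertTensor_induction with
  | closed => exact isClosed_eq (by fun_prop) (by fun_prop)
  | add z w hz hw => rw [map_add, inner_add_left, inner_add_left, hz, hw]
  | tmul v l =>
    rw [opTensor_tensorRight, opTensor_tensorRight, inner_tensorRight, inner_tensorRight,
      ContinuousLinearMap.star_eq_adjoint, ContinuousLinearMap.star_eq_adjoint,
      ContinuousLinearMap.adjoint_inner_right, ContinuousLinearMap.adjoint_inner_right]

theorem opTensor_nonneg {a : K →L[ℂ] K} {b : H →L[ℂ] H} (ha : 0 ≤ a) (hb : 0 ≤ b) :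
    0 ≤ opTensor a b := by
  obtain ⟨c, rfl⟩ := CStarAlgebra.nonneg_iff_eq_star_mul_self.mp ha
  obtain ⟨d, rfl⟩ := CStarAlgebra.nonneg_iff_eq_star_mul_self.mp hb
  rw [opTensor_mul, ← star_opTensor]
  exact star_mul_self_nonneg (opTensor c d)

theorem nonneg_of_opTensor_one_nonneg [Nontrivial H] {a : K →L[ℂ] K}
    (h : 0 ≤ opTensor a (1 : H →L[ℂ] H)) : 0 ≤ a := by
  obtain ⟨u, hu⟩ := exists_norm_eq H zero_le_one
  refine nonneg_iff_forall_inner.mpr fun k => ?_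
  have h1 := nonneg_iff_forall_inner.mp h (tensorRight u k)
  rwa [opTensor_tensorRight, inner_tensorRight, one_apply_eq_self, inner_self_eq_norm_sq_to_K, hu,
    RCLike.ofReal_one, one_pow, mul_one] at h1

end OpTensor

/-! ### Sets closed under bounded pointwise weak convergence -/

section BWClosed

variable {K H ι : Type*} [NormedAddCommGroup K] [InnerProductSpace ℂ K] [CompleteSpace K]
  [NormedAddCommGroup H] [InnerProductSpace ℂ H] [CompleteSpace H] (e : HilbertBasis ι ℂ H)
  {A : Submodule ℂ (K →L[ℂ] K)}

theorem IsBWClosed.preimage_add {S : Set ((H →L[ℂ] H) →L[ℂ] (H →L[ℂ] H))} (hS : IsBWClosed S)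
    (β : (H →L[ℂ] H) →L[ℂ] (H →L[ℂ] H)) : IsBWClosed {α | α + β ∈ S} := by
  intro l r α hl hb hlim
  refine hS (l.map (· + β)) (r + ‖β‖) _ (hl.map _) ?_ fun b ξ η => ?_
  · rw [eventually_map]
    filter_upwards [hb] with γ hγ
    exact ⟨hγ.1, (norm_add_le _ _).trans (by gcongr; exact hγ.2)⟩
  · rw [tendsto_map'_iff]
    simpa [Function.comp_def, inner_add_right] using (hlim b ξ η).add_const ⟪ξ, β b η⟫_ℂ

theorem IsBWClosed.preimage_smul {S : Set ((H →L[ℂ] H) →L[ℂ] (H →L[ℂ] H))} (hS : IsBWClosed S)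
    (c : ℂ) : IsBWClosed {α | c • α ∈ S} := by
  intro l r α hl hb hlim
  refine hS (l.map (c • ·)) (‖c‖ * r) _ (hl.map _) ?_ fun b ξ η => ?_
  · rw [eventually_map]
    filter_upwards [hb] with γ hγ
    refine ⟨hγ.1, ?_⟩
    rw [norm_smul]
    gcongr
    exact hγ.2
  · rw [tendsto_map'_iff]
    simpa [Function.comp_def, inner_smul_right] using (hlim b ξ η).const_mul c

theorem isBWClosed_setOf_nonneg_apply :
    IsBWClosed {α : (H →L[ℂ] H) →L[ℂ] (H →L[ℂ] H) | ∀ x, 0 ≤ x → 0 ≤ α x} := by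
  intro l r α hl hb hlim x hx
  refine nonneg_iff_forall_inner.mpr fun ζ => ge_of_tendsto (hlim x ζ ζ) ?_
  filter_upwards [hb] with γ hγ
  exact nonneg_iff_forall_inner.mp (hγ.1 x hx) ζ

/-- Weak convergence of a bounded net of operators on `K ⊗ H` can be tested on elementary
tensors. -/
theorem tendsto_inner_of_tensorRight {I : Type*} {l : Filter I}
    {S : I → HilbertTensor K H →L[ℂ] HilbertTensor K H}
    {T : HilbertTensor K H →L[ℂ] HilbertTensor K H} {C : ℝ} (hS : ∀ᶠ i in l, ‖S i‖ ≤ C)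
    (hT : ‖T‖ ≤ C) (h : ∀ (u : H) (k : K) (v : H) (m : K),
      Tendsto (fun i => ⟪tensorRight u k, S i (tensorRight v m)⟫_ℂ) l
        (𝓝 ⟪tensorRight u k, T (tensorRight v m)⟫_ℂ)) (ζ ζ' : HilbertTensor K H) :
    Tendsto (fun i => ⟪ζ, S i ζ'⟫_ℂ) l (𝓝 ⟪ζ, T ζ'⟫_ℂ) := by
  have hbound : ∀ R : HilbertTensor K H →L[ℂ] HilbertTensor K H, ‖R‖ ≤ C →
      ∀ ξ ξ' : HilbertTensor K H, ‖⟪ξ, R ξ'⟫_ℂ‖ ≤ C * ‖ξ‖ * ‖ξ'‖ := fun R hR ξ ξ' => by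
    refine (norm_inner_le_norm _ _).trans ?_
    calc ‖ξ‖ * ‖R ξ'‖ ≤ ‖ξ‖ * (C * ‖ξ'‖) := by
          gcongr; exact ContinuousLinearMap.le_of_opNorm_le _ hR ξ'
      _ = _ := by ring
  have hleft : ∀ R : HilbertTensor K H →L[ℂ] HilbertTensor K H, ‖R‖ ≤ C →
      ∀ ξ ξ' : HilbertTensor K H, ‖⟪ξ, R ζ'⟫_ℂ - ⟪ξ', R ζ'⟫_ℂ‖ ≤ C * ‖ζ'‖ * ‖ξ - ξ'‖ :=
    fun R hR ξ ξ' => by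
      rw [← inner_sub_left, mul_right_comm]
      exact hbound R hR _ _
  have hright : ∀ (z : HilbertTensor K H) (R : HilbertTensor K H →L[ℂ] HilbertTensor K H),
      ‖R‖ ≤ C → ∀ ξ ξ' : HilbertTensor K H,
        ‖⟪z, R ξ⟫_ℂ - ⟪z, R ξ'⟫_ℂ‖ ≤ C * ‖z‖ * ‖ξ - ξ'‖ :=
    fun z R hR ξ ξ' => by
      rw [← inner_sub_right, ← map_sub]
      exact hbound R hR _ _
  induction ζ using hilbertTensor_induction with
  | closed =>
    exact isClosed_setOf_tendsto_of_lipschitz (hS.mono fun i hi => hleft _ hi) (hleft T hT)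
  | add ξ ξ' h h' => simpa only [inner_add_left] using h.add h'
  | tmul u k =>
    clear hleft
    induction ζ' using hilbertTensor_induction with
    | closed =>
      exact isClosed_setOf_tendsto_of_lipschitz (hS.mono fun i hi => hright (tensorRight u k) _ hi)
        (hright (tensorRight u k) T hT)
    | add ξ ξ' h h' => simpa only [map_add, inner_add_right] using h.add h'
    | tmul v m => exact h u k v m

/-- The operators `(ι ⊗ β)(x)` converge weakly when a bounded net of maps `β` converges pointwise
weakly. -/
theorem tendsto_inner_idTensor {l : Filter ((H →L[ℂ] H) →L[ℂ] (H →L[ℂ] H))} {r : ℝ}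
    {α : (H →L[ℂ] H) →L[ℂ] (H →L[ℂ] H)} (hb : ∀ᶠ β in l, ‖β‖ ≤ r)
    (hlim : ∀ (b : H →L[ℂ] H) (ξ η : H),
      Tendsto (fun β => ⟪ξ, β b η⟫_ℂ) l (𝓝 ⟪ξ, α b η⟫_ℂ))
    (x : ProjTensor A (TraceClass H)) (ζ ζ' : HilbertTensor K H) :
    Tendsto (fun β => ⟪ζ, idTensor β x ζ'⟫_ℂ) l (𝓝 ⟪ζ, idTensor α x ζ'⟫_ℂ) := by
  set R := max r ‖α‖
  have hRα : ‖α‖ ≤ R := le_max_right _ _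
  have hbR : ∀ᶠ β in l, ‖β‖ ≤ R := hb.mono fun β hβ => hβ.trans (le_max_left _ _)
  have hnorm : ∀ β : (H →L[ℂ] H) →L[ℂ] (H →L[ℂ] H), ‖β‖ ≤ R →
      ∀ y : ProjTensor A (TraceClass H), ‖idTensor β y‖ ≤ R * ‖y‖ := fun β hβ y =>
    (norm_idTensor_le β y).trans (by gcongr)
  induction x using ProjTensor.induction with
  | closed =>
    have h : ∀ β : (H →L[ℂ] H) →L[ℂ] (H →L[ℂ] H), ‖β‖ ≤ R →
        ∀ y z : ProjTensor A (TraceClass H),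
          ‖⟪ζ, idTensor β y ζ'⟫_ℂ - ⟪ζ, idTensor β z ζ'⟫_ℂ‖ ≤ R * ‖ζ‖ * ‖ζ'‖ * ‖y - z‖ :=
      fun β hβ y z => by
        rw [← inner_sub_right, ← sub_apply, ← map_sub]
        refine (norm_inner_le_norm _ _).trans ?_
        calc _ ≤ ‖ζ‖ * (R * ‖y - z‖ * ‖ζ'‖) := by
              gcongr; exact ContinuousLinearMap.le_of_opNorm_le _ (hnorm β hβ _) ζ'
          _ = _ := by ring
    exact isClosed_setOf_tendsto_of_lipschitz (hbR.mono h) (h α hRα)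
  | add x y hx hy => simpa only [map_add, add_apply, inner_add_right] using hx.add hy
  | mk a b =>
    refine tendsto_inner_of_tensorRight (S := fun β => idTensor β (ProjTensor.mk a b))
      (hbR.mono fun β hβ => hnorm β hβ _) (hnorm α hRα _) (fun u k v m => ?_) ζ ζ'
    simp only [idTensor_mk, opTensor_tensorRight, inner_tensorRight]
    exact (hlim b.op u v).const_mul _

theorem isBWClosed_setOf_idTensor_nonneg (x : ProjTensor A (TraceClass H)) :
    IsBWClosed {α : (H →L[ℂ] H) →L[ℂ] (H →L[ℂ] H) | 0 ≤ idTensor α x} := by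
  intro l r α hl hb hlim
  refine nonneg_iff_forall_inner.mpr fun ζ => ge_of_tendsto
    (tendsto_inner_idTensor (hb.mono fun _ h => h.2) hlim x ζ ζ) ?_
  filter_upwards [hb] with γ hγ
  exact nonneg_iff_forall_inner.mp hγ.1 ζ

end BWClosed

/-! ### The mapping cone generated by the elementary maps -/

section SeparableCone

variable {K H ι : Type*} [NormedAddCommGroup K] [InnerProductSpace ℂ K] [CompleteSpace K]
  [NormedAddCommGroup H] [InnerProductSpace ℂ H] [CompleteSpace H] (e : HilbertBasis ι ℂ H)
  {A : Submodule ℂ (K →L[ℂ] K)}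

theorem NuclearRep.comp_right {b : H →L[ℂ] H} {ξ η : ℕ → H} (h : NuclearRep b ξ η)
    (c : H →L[ℂ] H) :
    NuclearRep (b ∘L c) ξ (fun n => ContinuousLinearMap.adjoint c (η n)) where
  summable := by
    refine Summable.of_nonneg_of_le (fun n => by positivity) (fun n => ?_)
      (h.summable.mul_left ‖ContinuousLinearMap.adjoint c‖)
    calc ‖ξ n‖ * ‖ContinuousLinearMap.adjoint c (η n)‖
        ≤ ‖ξ n‖ * (‖ContinuousLinearMap.adjoint c‖ * ‖η n‖) := by
          gcongr; exact ContinuousLinearMap.le_opNorm _ _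
      _ = _ := by ring
  hasSum x := by
    simp only [ContinuousLinearMap.adjoint_inner_left]
    exact h.hasSum (c x)

/-- If `x ↦ Tr (x ρ)` is a normal functional, then so is `x ↦ c Tr (b x b* ρ)`. -/
theorem exists_density_conj (ρ : TraceClass H) (c : ℂ) (b : H →L[ℂ] H) :
    ∃ σ : TraceClass H, ∀ x, c * trace e ((b * x * star b) ∘L ρ.op) = trace e (x ∘L σ.op) := by
  obtain ⟨ξ, η, h⟩ := ρ.exists_rep
  have h1 := ((h.comp_right b).comp_left (star b)).smul c
  refine ⟨⟨_, _, _, h1⟩, fun x => ?_⟩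
  have h2 := (h.comp_left (b * x * star b)).hasSum_trace e
  have h3 := (h1.comp_left x).hasSum_trace e
  have h4 : trace e (x ∘L TraceClass.op ⟨_, _, _, h1⟩) =
      ∑' n, ⟪ContinuousLinearMap.adjoint b (η n), x (c • star b (ξ n))⟫_ℂ := h3.tsum_eq
  rw [h4, trace, h2.tsum_eq, ← tsum_mul_left]
  refine tsum_congr fun n => ?_
  rw [map_smul, inner_smul_right, ContinuousLinearMap.adjoint_inner_left]
  rfl

theorem apply_eq_zero_of_apply_one_eq_zero {ω : (H →L[ℂ] H) →L[ℂ] ℂ}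
    (hω : ∀ b, 0 ≤ b → 0 ≤ ω b) (h1 : ω 1 = 0) (x : H →L[ℂ] H) : ω x = 0 := by
  have hsa : ∀ y : H →L[ℂ] H, IsSelfAdjoint y → ω y = 0 := fun y hy => by
    have h2 : algebraMap ℝ (H →L[ℂ] H) ‖y‖ = (‖y‖ : ℂ) • 1 := by
      rw [Algebra.algebraMap_eq_smul_one, Complex.coe_smul]
    have h3 := hω _ (neg_le_iff_add_nonneg.mp hy.neg_algebraMap_norm_le_self)
    have h4 := hω _ (sub_nonneg.mpr hy.le_algebraMap_norm_self)
    rw [map_add, h2, map_smul, h1, smul_zero, add_zero] at h3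
    rw [map_sub, h2, map_smul, h1, smul_zero, zero_sub, neg_nonneg] at h4
    exact le_antisymm h4 h3
  rw [← realPart_add_I_smul_imaginaryPart x, map_add, map_smul, hsa _ (realPart x).2,
    hsa _ (imaginaryPart x).2, smul_zero, add_zero]

/-- The functional `x ↦ ω(b x b*)` is a nonnegative multiple of a normal state. -/
theorem IsNormalState.exists_conj {ω : (H →L[ℂ] H) →L[ℂ] ℂ} (hω : IsNormalState e ω)
    (b : H →L[ℂ] H) :
    ∃ (c : ℝ) (ω' : (H →L[ℂ] H) →L[ℂ] ℂ), 0 ≤ c ∧ IsNormalState e ω' ∧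
      ∀ x, ω (b * x * star b) = c * ω' x := by
  let θ : (H →L[ℂ] H) →L[ℂ] ℂ :=
    ω.comp (ContinuousLinearMap.mulLeftRight ℂ (H →L[ℂ] H) b (star b))
  have hθ : ∀ x, θ x = ω (b * x * star b) := fun x => rfl
  have hpos : ∀ x, 0 ≤ x → 0 ≤ θ x := fun x hx =>
    hω.nonneg _ (star_right_conjugate_nonneg hx b)
  obtain ⟨hc, him⟩ := Complex.nonneg_iff.mp (hpos 1 zero_le_one)
  have hc' : θ 1 = ((θ 1).re : ℂ) := Complex.ext rfl (by simp [← him])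
  set c := (θ 1).re
  rcases hc.eq_or_lt with h0 | h0
  · refine ⟨0, ω, le_rfl, hω, fun x => ?_⟩
    rw [← hθ, apply_eq_zero_of_apply_one_eq_zero hpos (by rw [hc', ← h0, Complex.ofReal_zero])]
    simp
  · have hc0 : (c : ℂ) ≠ 0 := Complex.ofReal_ne_zero.mpr h0.ne'
    refine ⟨c, (c : ℂ)⁻¹ • θ, hc, ⟨fun x hx => ?_, ?_, ?_⟩, fun x => ?_⟩
    · rw [smul_apply, smul_eq_mul, ← Complex.ofReal_inv]
      exact mul_nonneg (Complex.zero_le_real.mpr (inv_nonneg.mpr hc)) (hpos x hx)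
    · rw [smul_apply, hc', smul_eq_mul, inv_mul_cancel₀ hc0]
    · obtain ⟨ρ, hρ⟩ := hω.normal
      obtain ⟨σ, hσ⟩ := exists_density_conj e ρ (c : ℂ)⁻¹ b
      exact ⟨σ, fun x => by rw [smul_apply, hθ, hρ, smul_eq_mul, hσ]⟩
    · rw [smul_apply, smul_eq_mul, mul_inv_cancel_left₀ hc0, hθ]

theorem isNormalState_vector {u : H} (hu : ‖u‖ = 1) :
    IsNormalState e ((innerSL ℂ u).comp (ContinuousLinearMap.apply ℂ H u)) where
  nonneg b hb := nonneg_iff_forall_inner.mp hb u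
  map_one := by
    change ⟪u, u⟫_ℂ = 1
    rw [inner_self_eq_norm_sq_to_K, hu]
    simp
  normal := by
    refine ⟨.rankOne u u, fun b => ?_⟩
    rw [TraceClass.op_rankOne, trace,
      (((nuclearRep_rankOne u u).comp_left b).hasSum_trace e).tsum_eq,
      tsum_eq_single 0 fun n hn => by simp [Pi.single_eq_of_ne hn]]
    simp

theorem elementaryMaps_add {α β : (H →L[ℂ] H) →L[ℂ] (H →L[ℂ] H)} (hα : α ∈ elementaryMaps e)
    (hβ : β ∈ elementaryMaps e) : α + β ∈ elementaryMaps e := by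
  obtain ⟨n, ω, a, h1, h2, h3⟩ := hα
  obtain ⟨m, ω', a', h1', h2', h3'⟩ := hβ
  refine ⟨n + m, Fin.append ω ω', Fin.append a a', fun i => ?_, fun i => ?_, fun x => ?_⟩
  · induction i using Fin.addCases with
    | left i => rw [Fin.append_left]; exact h1 i
    | right i => rw [Fin.append_right]; exact h1' i
  · induction i using Fin.addCases with
    | left i => rw [Fin.append_left]; exact h2 i
    | right i => rw [Fin.append_right]; exact h2' i
  · rw [Fin.sum_univ_add, add_apply, h3, h3']
    simp only [Fin.append_left, Fin.append_right]

theorem elementaryMaps_smul {α : (H →L[ℂ] H) →L[ℂ] (H →L[ℂ] H)} (hα : α ∈ elementaryMaps e)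
    {r : ℝ} (hr : 0 ≤ r) : (r : ℂ) • α ∈ elementaryMaps e := by
  obtain ⟨n, ω, a, h1, h2, h3⟩ := hα
  refine ⟨n, ω, fun i => (r : ℂ) • a i, h1, fun i => ?_, fun x => ?_⟩
  · change 0 ≤ (r : ℂ) • a i
    rw [Complex.coe_smul]
    exact smul_nonneg hr (h2 i)
  · rw [smul_apply, h3, Finset.smul_sum]
    exact Finset.sum_congr rfl fun i _ => smul_comm _ _ _

theorem elementaryMaps_conj {α : (H →L[ℂ] H) →L[ℂ] (H →L[ℂ] H)} (hα : α ∈ elementaryMaps e)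
    (a b : H →L[ℂ] H) :
    ∃ β ∈ elementaryMaps e, ∀ x, β x = a * α (b * x * star b) * star a := by
  obtain ⟨n, ω, d, h1, h2, h3⟩ := hα
  choose c ω' hc hω' h using fun i => (h1 i).exists_conj e b
  refine ⟨((ContinuousLinearMap.mulLeftRight ℂ (H →L[ℂ] H) a (star a)).comp α).comp
    (ContinuousLinearMap.mulLeftRight ℂ (H →L[ℂ] H) b (star b)), ?_, fun x => rfl⟩
  refine ⟨n, ω', fun i => (c i : ℂ) • (a * d i * star a), hω', fun i => ?_, fun x => ?_⟩
  · change 0 ≤ (c i : ℂ) • (a * d i * star a)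
    rw [Complex.coe_smul]
    exact smul_nonneg (hc i) (star_right_conjugate_nonneg (h2 i) a)
  · change a * α (b * x * star b) * star a = _
    rw [h3, Finset.mul_sum, Finset.sum_mul]
    refine Finset.sum_congr rfl fun i _ => ?_
    rw [h, mul_smul_comm, smul_mul_assoc, smul_smul, mul_comm (ω' i x)]

theorem elementaryMaps_nonneg {α : (H →L[ℂ] H) →L[ℂ] (H →L[ℂ] H)} (hα : α ∈ elementaryMaps e)
    {x : H →L[ℂ] H} (hx : 0 ≤ x) : 0 ≤ α x := by
  obtain ⟨n, ω, a, h1, h2, h3⟩ := hα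
  rw [h3]
  refine Finset.sum_nonneg fun i _ => ?_
  obtain ⟨hre, him⟩ := Complex.nonneg_iff.mp ((h1 i).nonneg x hx)
  have h : ω i x = ((ω i x).re : ℂ) := Complex.ext rfl (by simp [← him])
  rw [h, Complex.coe_smul]
  exact smul_nonneg hre (h2 i)

theorem smulRight_mem_elementaryMaps {ω : (H →L[ℂ] H) →L[ℂ] ℂ} (hω : IsNormalState e ω)
    {a : H →L[ℂ] H} (ha : 0 ≤ a) : ω.smulRight a ∈ elementaryMaps e :=
  ⟨1, fun _ => ω, fun _ => a, fun _ => hω, fun _ => ha, fun x => by simp⟩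

/-- The smallest set containing the elementary maps which is closed under bounded pointwise weak
convergence. -/
def elementaryClosure : Set ((H →L[ℂ] H) →L[ℂ] (H →L[ℂ] H)) :=
  {α | ∀ S, IsBWClosed S → elementaryMaps e ⊆ S → α ∈ S}

theorem elementaryMaps_subset_elementaryClosure : elementaryMaps e ⊆ elementaryClosure e :=
  fun _ hα _ _ h => h hα

theorem isBWClosed_elementaryClosure : IsBWClosed (elementaryClosure e) :=
  fun l r α hl hb hlim S hS h =>
    hS l r α hl (hb.mono fun _ hβ => ⟨hβ.1 S hS h, hβ.2⟩) hlim

theorem isMappingCone_elementaryClosure [Nontrivial H] : IsMappingCone (elementaryClosure e) where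
  pos α hα := hα _ isBWClosed_setOf_nonneg_apply fun _ hβ _ hx => elementaryMaps_nonneg e hβ hx
  ne_zero := by
    obtain ⟨u, hu⟩ := exists_norm_eq H zero_le_one
    have hω := isNormalState_vector e hu
    refine ⟨_, elementaryMaps_subset_elementaryClosure e
      (smulRight_mem_elementaryMaps e hω zero_le_one), fun h => ?_⟩
    have h1 := DFunLike.congr_fun h (1 : H →L[ℂ] H)
    rw [ContinuousLinearMap.smulRight_apply, hω.map_one, one_smul] at h1
    exact one_ne_zero h1
  add_mem α hα β hβ := by
    -- The closure is additive in one variable with the other one elementary, hence in both.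
    have h1 : ∀ γ ∈ elementaryMaps e, α + γ ∈ elementaryClosure e := fun γ hγ =>
      hα _ ((isBWClosed_elementaryClosure e).preimage_add γ) fun δ hδ =>
        elementaryMaps_subset_elementaryClosure e (elementaryMaps_add e hδ hγ)
    rw [add_comm]
    refine hβ _ ((isBWClosed_elementaryClosure e).preimage_add α) fun γ hγ => ?_
    change γ + α ∈ elementaryClosure e
    rw [add_comm]
    exact h1 γ hγ
  smul_mem r hr α hα := hα _ ((isBWClosed_elementaryClosure e).preimage_smul r) fun _ hβ =>
    elementaryMaps_subset_elementaryClosure e (elementaryMaps_smul e hβ hr)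
  closed := isBWClosed_elementaryClosure e
  dense := by
    refine ⟨elementaryMaps e, elementaryMaps_subset_elementaryClosure e,
      fun S hS h α hα => hα S hS h, fun α hα a b => ?_⟩
    obtain ⟨β, hβ, h⟩ := elementaryMaps_conj e hα a b
    exact ⟨β, elementaryMaps_subset_elementaryClosure e hβ, h⟩

theorem idTensor_eq_sum {n : ℕ} {α : (H →L[ℂ] H) →L[ℂ] (H →L[ℂ] H)}
    {ω : Fin n → (H →L[ℂ] H) →L[ℂ] ℂ} {a : Fin n → (H →L[ℂ] H)}
    (h : ∀ b, α b = ∑ i, ω i b • a i) (x : ProjTensor A (TraceClass H)) :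
    idTensor α x = ∑ i, opTensor (idTensorFunctional (ω i) x) (a i) := by
  simp only [← opTensorL_apply]
  induction x using ProjTensor.induction with
  | closed => exact isClosed_eq (by fun_prop) (by fun_prop)
  | add x y hx hy => simp only [map_add, add_apply, hx, hy, Finset.sum_add_distrib]
  | mk c b =>
    simp only [idTensor_mk, idTensorFunctional_mk, h, ← opTensorL_apply, map_sum, map_smul,
      smul_apply]

/-- The cone that defines entanglement breaking maps consists of the elements all of whose slices by
normal states are positive. -/
theorem mem_coneP_separableCone_iff (x : ProjTensor A (TraceClass H)) :
    x ∈ coneP A (separableCone e) ↔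
      ∀ ω : (H →L[ℂ] H) →L[ℂ] ℂ, IsNormalState e ω → 0 ≤ idTensorFunctional ω x := by
  constructor
  · intro hx ω hω
    have : Nontrivial H := by
      by_contra hH
      rw [not_nontrivial_iff_subsingleton] at hH
      have h := hω.map_one
      rw [Subsingleton.elim (1 : H →L[ℂ] H) 0, map_zero] at h
      exact zero_ne_one h
    have h := hx (ω.smulRight 1) fun C _ hC =>
      hC (smulRight_mem_elementaryMaps e hω zero_le_one)
    rw [idTensor_eq_sum (n := 1) (ω := fun _ => ω) (a := fun _ => 1) (fun b => by simp)] at h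
    simp only [Finset.univ_unique, Finset.sum_const, Finset.card_singleton, one_smul] at h
    exact nonneg_of_opTensor_one_nonneg h
  · intro hx α hα
    -- If `H = 0` there are no mapping cones and `S(H)` is everything, but then `(ι ⊗ α)(x) = 0`.
    rcases subsingleton_or_nontrivial H with hH | hH
    · have h := norm_idTensor_le (A := A) α x
      have hα0 : ‖α‖ = 0 := by rw [Subsingleton.elim α 0, norm_zero]
      rw [hα0, zero_mul] at h
      refine nonneg_iff_forall_inner.mpr fun ζ => ?_
      have h1 := ContinuousLinearMap.le_of_opNorm_le _ h ζ
      rw [zero_mul, norm_le_zero_iff] at h1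
      rw [h1, inner_zero_right]
    · refine hα _ (isMappingCone_elementaryClosure e) (elementaryMaps_subset_elementaryClosure e) _
        (isBWClosed_setOf_idTensor_nonneg x) ?_
      rintro β ⟨n, ω, a, h1, h2, h3⟩
      change 0 ≤ idTensor β x
      rw [idTensor_eq_sum h3]
      exact Finset.sum_nonneg fun i _ => opTensor_nonneg (hx _ (h1 i)) (h2 i)

end SeparableCone

end PosMap

theorem proposition1 {K H ι : Type*}
    [NormedAddCommGroup K] [InnerProductSpace ℂ K] [CompleteSpace K]
    [NormedAddCommGroup H] [InnerProductSpace ℂ H] [CompleteSpace H]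
    (e : HilbertBasis ι ℂ H)
    (A : Submodule ℂ (K →L[ℂ] K)) (hA : IsOperatorSystem A)
    (φ : A →L[ℂ] (H →L[ℂ] H)) (hφ : IsPositiveMap φ) :
    (IsDecomposable e φ ↔
      ∀ x ∈ {x : ProjTensor A (TraceClass H) | x ∈ posCone H A ∧ 0 ≤ idTensor (transpose e) x},
        0 ≤ dualFunctional e φ x) ∧
    (IsEntanglementBreaking e φ ↔
      ∀ x ∈ {x : ProjTensor A (TraceClass H) | ∀ ω : (H →L[ℂ] H) →L[ℂ] ℂ, IsNormalState e ω →
          0 ≤ idTensorFunctional ω x},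
        0 ≤ dualFunctional e φ x) := by
  refine ⟨⟨fun h x hx => h.dualFunctional_nonneg e hA x hx.1 hx.2, fun h =>
    isDecomposable_of_dualFunctional_nonneg e hA hφ fun x hx hxt => h x ⟨hx, hxt⟩⟩, ?_⟩
  exact forall_congr' fun x => by rw [mem_coneP_separableCone_iff]; rfl
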